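/- Let $K$ be a field, let $G$ be a simple graph on $[n]=\{1,\dots,n\}$, and let $S=K[x_1,\dots,x_n,y_1,\dots,y_n]$ with the $\mathbb{Z}^n$-grading $\deg x_i=\deg y_i=e_i$. Let $J_G=(x_iy_j-x_jy_i : \{i,j\}\text{ is an edge of }G)\subseteq S$ be the binomial edge ideal of $G$. A $\mathbb{Z}^n$-graded linear change of coordinates is an element $g=(g_1,\dots,g_n)\in GL_2(K)^n$, where $g_i$ acts on $Kx_i\oplus Ky_i$. (1) Suppose that $K$ is infinite, and let $\tau$ be any term order on $S$ with $x_i>y_i$ for all $i$. Then the $\mathbb{Z}^n$-graded generic initial ideal of $J_G$ with respect to $\tau$, that is, the common value of $\mathrm{in}_\tau(g(J_G))$ for all $g$ in some nonempty Zariski open subset of $GL_2(K)^n$, is the ideal generated by the monomials $y_{a_1}\cdots y_{a_v}x_ix_j$ ($v\ge 0$) such that $i,a_1,\dots,a_v,j$ is a path in $G$, i.e. a sequence of pairwise distinct vertices in which any two consecutive ones are adjacent. (2) $J_G$ is a Cartwright–Sturmfels ideal: it is $\mathbb{Z}^n$-graded, and there is a radical Borel fixed ideal $J$ of $S$ with the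 same $\mathbb{Z}^n$-graded Hilbert series as $J_G$. Here a monomial ideal is Borel fixed if it is mapped onto itself by all substitutions $x_i\mapsto \beta_i x_i$, $y_i\mapsto \alpha_i x_i+\gamma_i y_i$ with $\alpha_i\in K$ and $\beta_i,\gamma_i\in K\setminus\{0\}$. (3) All the initial ideals of $J_G$ are radical, also after a $\mathbb{Z}^n$-graded change of coordinates: for every term order $\tau$ on $S$ and every $g\in GL_2(K)^n$ (in particular for $g=1$), the ideal $\mathrm{in}_\tau(g(J_G))$ is radical. (4) $\mathrm{reg}(J_G)\le n$, where $\mathrm{reg}(I)=\sup\{j-i : \mathrm{Tor}_i^S(I,K)_j\ne 0\}$ is the Castelnuovo–Mumford regularity with respect to the standard $\mathbb{Z}$-grading (and $\mathrm{reg}(0)=-\infty$). -/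

import Mathlib

open MvPolynomial

universe u w

namespace BinomialEdge

/-! Throughout, `K[x₁,…,xₙ,y₁,…,yₙ]` is `MvPolynomial (Fin n × Fin 2) K`,
with `xᵢ = X (i, 0)` and `yᵢ = X (i, 1)`. -/

/-! ### The `ℤⁿ`-grading -/

/-- The degree of a variable: `deg xᵢ = deg yᵢ = eᵢ`. -/
noncomputable def mdeg {n : ℕ} (v : Fin n × Fin 2) : Fin n →₀ ℕ :=
  Finsupp.single v.1 1

/-- `I` is a `ℤⁿ`-graded ideal: it contains the multigraded components of its elements. -/
def IsMultigraded {K : Type u} [Field K] {n : ℕ}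
    (I : Ideal (MvPolynomial (Fin n × Fin 2) K)) : Prop :=
  ∀ f ∈ I, ∀ a : Fin n →₀ ℕ, weightedHomogeneousComponent mdeg a f ∈ I

/-- The graded component `I_a`, as a `K`-subspace of the polynomial ring. -/
noncomputable def component {K : Type u} [Field K] {n : ℕ}
    (I : Ideal (MvPolynomial (Fin n × Fin 2) K)) (a : Fin n →₀ ℕ) :
    Submodule K (MvPolynomial (Fin n × Fin 2) K) :=
  I.restrictScalars K ⊓ weightedHomogeneousSubmodule K mdeg a

/-- The `ℤⁿ`-graded Hilbert series `HS(I, z) = ∑ₐ dim_K(I_a) zᵃ`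
(the components in degrees outside `ℕⁿ` vanish). -/
noncomputable def hilbertSeries {K : Type u} [Field K] {n : ℕ}
    (I : Ideal (MvPolynomial (Fin n × Fin 2) K)) : MvPowerSeries (Fin n) ℚ :=
  fun a => (Module.finrank K (component I a) : ℚ)

/-! ### Multigraded coordinate changes, Borel fixed ideals -/

/-- The `K`-algebra endomorphism of the polynomial ring given by a family of `2 × 2` matrices:
`xᵢ ↦ (gᵢ)₀₀ xᵢ + (gᵢ)₁₀ yᵢ` and `yᵢ ↦ (gᵢ)₀₁ xᵢ + (gᵢ)₁₁ yᵢ`. For `g` in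
`GL₂(K)ⁿ` these are exactly the `ℤⁿ`-graded linear changes of coordinates. -/
noncomputable def coordChange {K : Type u} [Field K] {n : ℕ} (g : Fin n → GL (Fin 2) K) :
    MvPolynomial (Fin n × Fin 2) K →ₐ[K] MvPolynomial (Fin n × Fin 2) K :=
  aeval fun v => ∑ k : Fin 2, C ((g v.1 : Matrix (Fin 2) (Fin 2) K) k v.2) * X (v.1, k)

/-- `I` is generated by monomials. -/
def IsMonomialIdeal {K : Type u} [Field K] {n : ℕ}
    (I : Ideal (MvPolynomial (Fin n × Fin 2) K)) : Prop :=
  ∃ s : Set (Fin n × Fin 2 →₀ ℕ), I = Ideal.span ((fun d => monomial d (1 : K)) '' s)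

/-- `I` is Borel fixed: a monomial ideal mapped onto itself by every family of upper triangular
invertible matrices. (If `K` is infinite, invariance under the diagonal matrices already forces
`I` to be monomial.) -/
def IsBorelFixed {K : Type u} [Field K] {n : ℕ}
    (I : Ideal (MvPolynomial (Fin n × Fin 2) K)) : Prop :=
  IsMonomialIdeal I ∧
    ∀ g : Fin n → GL (Fin 2) K, (∀ i, (g i : Matrix (Fin 2) (Fin 2) K) 1 0 = 0) →
      I.map (coordChange g) = I

/-- Cartwright–Sturmfels ideals: `ℤⁿ`-graded ideals having the Hilbert series of a radical
Borel fixed ideal. -/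
def IsCartwrightSturmfels {K : Type u} [Field K] {n : ℕ}
    (I : Ideal (MvPolynomial (Fin n × Fin 2) K)) : Prop :=
  IsMultigraded I ∧
    ∃ J : Ideal (MvPolynomial (Fin n × Fin 2) K),
      J.IsRadical ∧ IsBorelFixed J ∧ hilbertSeries I = hilbertSeries J

/-! ### Initial ideals, generic initial ideals -/

/-- The initial ideal of `I` with respect to the term order `m`. -/
noncomputable def initialIdeal {K : Type u} [Field K] {n : ℕ}
    (m : MonomialOrder.{0, w} (Fin n × Fin 2)) (I : Ideal (MvPolynomial (Fin n × Fin 2) K)) :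
    Ideal (MvPolynomial (Fin n × Fin 2) K) :=
  Ideal.span (m.leadingTerm '' (I : Set (MvPolynomial (Fin n × Fin 2) K)))

/-- `J` is the `ℤⁿ`-graded generic initial ideal of `I` with respect to `m`: it is the initial
ideal of `g(I)` for all `g` in a nonempty Zariski open subset `{p ≠ 0}` of `GL₂(K)ⁿ`, where `p` is
a polynomial in the matrix entries. To be used over an infinite field, where two nonempty
Zariski open subsets of `GL₂(K)ⁿ` always meet, so that `J` is unique. -/
def IsMultigradedGin {K : Type u} [Field K] {n : ℕ}
    (m : MonomialOrder.{0, w} (Fin n × Fin 2))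
    (I J : Ideal (MvPolynomial (Fin n × Fin 2) K)) : Prop :=
  ∃ p : MvPolynomial (Fin n × Fin 2 × Fin 2) K,
    (∃ g : Fin n → GL (Fin 2) K,
      eval (fun e => (g e.1 : Matrix (Fin 2) (Fin 2) K) e.2.1 e.2.2) p ≠ 0) ∧
    ∀ g : Fin n → GL (Fin 2) K,
      eval (fun e => (g e.1 : Matrix (Fin 2) (Fin 2) K) e.2.1 e.2.2) p ≠ 0 →
        initialIdeal m (I.map (coordChange g)) = J

/-! ### Castelnuovo–Mumford regularity

The graded Betti numbers `β_{i,j}(I) = dim_K Tor_i(I, K)_j` are computed by the Koszul complex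
`K(x₁,y₁,…,xₙ,yₙ) ⊗ I`. An element `∑_T c_T e_T` of this complex, where `T` runs over the sets of
variables and `e_T = e_{v₁} ∧ ⋯ ∧ e_{vᵢ}` for `T = {v₁ < ⋯ < vᵢ}`, is encoded by the
function `T ↦ c_T`. -/

/-- The Koszul differential `e_{v₁} ∧ ⋯ ∧ e_{vᵢ} ↦ ∑ₖ (-1)^(k-1) vₖ e_{v₁} ∧ ⋯ ê_{vₖ} ⋯ ∧ e_{vᵢ}`,
the variables being ordered lexicographically by their indices. -/
noncomputable def koszulD {K : Type u} [Field K] {n : ℕ} :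
    (Finset (Fin n × Fin 2) → MvPolynomial (Fin n × Fin 2) K) →ₗ[K]
      (Finset (Fin n × Fin 2) → MvPolynomial (Fin n × Fin 2) K) where
  toFun c T := ∑ v ∈ Tᶜ,
    (-1) ^ (T.filter fun t => toLex t < toLex v).card * X v * c (insert v T)
  map_add' c d := by
    funext T
    simp only [Pi.add_apply, mul_add, Finset.sum_add_distrib]
  map_smul' a c := by
    funext T
    simp only [Pi.smul_apply, RingHom.id_apply, mul_smul_comm, Finset.smul_sum]

/-- The degree `j` part of the `i`-th term of the Koszul complex with coefficients in `I`:
the coefficients lie in `I`, are supported on the `T` with `i` elements, and are homogeneous with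
`deg c_T + |T| = j` (expressed by multiplying with the variables in `T`). -/
noncomputable def koszulChains {K : Type u} [Field K] {n : ℕ}
    (I : Ideal (MvPolynomial (Fin n × Fin 2) K)) (i j : ℕ) :
    Submodule K (Finset (Fin n × Fin 2) → MvPolynomial (Fin n × Fin 2) K) where
  carrier := {c | ∀ T, c T ∈ I ∧ (T.card ≠ i → c T = 0) ∧ (c T * ∏ v ∈ T, X v).IsHomogeneous j}
  zero_mem' := fun T => ⟨I.zero_mem, fun _ => rfl, by
    simpa using isHomogeneous_zero (Fin n × Fin 2) K j⟩
  add_mem' := fun {c d} hc hd T => ⟨I.add_mem (hc T).1 (hd T).1, fun h => by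
      simp [(hc T).2.1 h, (hd T).2.1 h], by
      rw [Pi.add_apply, add_mul]
      exact (hc T).2.2.add (hd T).2.2⟩
  smul_mem' := fun a c hc T => ⟨Submodule.smul_of_tower_mem I a (hc T).1, fun h => by
      simp [(hc T).2.1 h], by
      rw [Pi.smul_apply, smul_mul_assoc]
      exact Submodule.smul_mem (homogeneousSubmodule (Fin n × Fin 2) K j) a (hc T).2.2⟩

/-- The cycles of homological degree `i` and internal degree `j`. -/
noncomputable def koszulCycles {K : Type u} [Field K] {n : ℕ}
    (I : Ideal (MvPolynomial (Fin n × Fin 2) K)) (i j : ℕ) :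
    Submodule K (Finset (Fin n × Fin 2) → MvPolynomial (Fin n × Fin 2) K) :=
  koszulChains I i j ⊓ LinearMap.ker koszulD

/-- The boundaries of homological degree `i` and internal degree `j`. -/
noncomputable def koszulBoundaries {K : Type u} [Field K] {n : ℕ}
    (I : Ideal (MvPolynomial (Fin n × Fin 2) K)) (i j : ℕ) :
    Submodule K (Finset (Fin n × Fin 2) → MvPolynomial (Fin n × Fin 2) K) :=
  (koszulChains I (i + 1) j).map koszulD

/-- The graded Betti number `β_{i,j}(I)` of a homogeneous ideal `I`. -/
noncomputable def gradedBetti {K : Type u} [Field K] {n : ℕ}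
    (I : Ideal (MvPolynomial (Fin n × Fin 2) K)) (i j : ℕ) : ℕ :=
  Module.finrank K
    (koszulCycles I i j ⧸ (koszulBoundaries I i j).submoduleOf (koszulCycles I i j))

/-- The Castelnuovo–Mumford regularity `reg(I) = sup {j - i | β_{i,j}(I) ≠ 0}` of a homogeneous
ideal. Only `j = i + r` with `r ≥ 0` matter, since `β_{i,j}(I) = 0` for `j < i`.
The zero ideal has regularity `⊥ = -∞`. -/
noncomputable def regularity {K : Type u} [Field K] {n : ℕ}
    (I : Ideal (MvPolynomial (Fin n × Fin 2) K)) : WithBot ℕ∞ :=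
  ⨆ (i : ℕ) (r : ℕ) (_ : gradedBetti I i (i + r) ≠ 0), (r : WithBot ℕ∞)

/-! ### Binomial edge ideals -/

/-- The binomial edge ideal `J_G`, generated by the minors `xᵢyⱼ - xⱼyᵢ` for the edges
`{i, j}` of `G`. -/
noncomputable def binomialEdgeIdeal (K : Type u) [Field K] {n : ℕ} (G : SimpleGraph (Fin n)) :
    Ideal (MvPolynomial (Fin n × Fin 2) K) :=
  Ideal.span {f | ∃ i j : Fin n, G.Adj i j ∧ f = X (i, 0) * X (j, 1) - X (j, 0) * X (i, 1)}

/-- The ideal generated by the monomials `y_{a₁} ⋯ y_{aᵥ} xᵢ xⱼ`, where `i, a₁, …, aᵥ, j` is a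
path in `G` from `i` to `j ≠ i`. -/
noncomputable def pathIdeal (K : Type u) [Field K] {n : ℕ} (G : SimpleGraph (Fin n)) :
    Ideal (MvPolynomial (Fin n × Fin 2) K) :=
  Ideal.span {f | ∃ (i j : Fin n) (q : G.Walk i j), i ≠ j ∧ q.IsPath ∧
    f = (∏ a ∈ q.support.toFinset \ {i, j}, X (a, 1)) * X (i, 0) * X (j, 0)}

end BinomialEdge

namespace BinomialEdge

variable {K : Type u} [Field K] {n : ℕ}

/-! In multidegree $a$ everything is governed by the graph induced on the support $T$ of $a$. Write
$[ij]$ for the minor of $i$ and $j$. If $i$ and $j$ are joined inside $T$, every multiple of $[ij]$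
of multidegree $a$ lies in $J_G$ (`mul_minor_mem`). Conversely, the homomorphism `collapse`, which
identifies the variables within each component of $G|_T$, kills $J_G$, and in degree $a$ its kernel
is no larger than $J_G$. So $\dim (S/J_G)_a=\prod_C(1+\sum_{i\in C}a_i)$, which is `standardCount`.

For any $g$ and any term order, `leadSet` consists of the exponents divisible by the leading
monomial of some $g[ij]$ with $i,j$ joined in their support. At most `standardCount` exponents of
degree $a$ avoid it (`card_le_of_standard`), while the collapsed images of these monomials span a
space containing `standardCount` independent vectors. Hence equality holds, and `leadSet` gives the
whole initial ideal (`initialIdeal_map_coordChange`). It is radical: the leading monomials are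
products of two variables of distinct vertices, and joinedness depends on the support only. For
generic $g$ every leading monomial is $x_ix_j$, which yields the path ideal. This ideal is radical
and Borel fixed, and since the count does not see the field, it has the Hilbert series of $J_G$ over
finite fields too.

The regularity bound comes from the Koszul complex itself: its strand of multidegree $a$ is exact
where the coefficients have degree greater than $|T|$ (`exists_koszulD_eq`). The induction is on
$|T|$; it removes a vertex $k$ and compares $J_G$ with the ideal of the graph in which the neighbors
of $k$ are made pairwise adjacent. -/

/-! ### Multidegrees and generators of the binomial edge ideal -/

theorem weight_mdeg_apply {n : ℕ} (d : Fin n × Fin 2 →₀ ℕ) (i : Fin n) :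
    Finsupp.weight mdeg d i = d (i, 0) + d (i, 1) := by
  rw [Finsupp.weight_eq_sum, Finsupp.finsetSum_apply, Fintype.sum_prod_type]
  simp only [mdeg, Finsupp.smul_apply, Finsupp.single_apply, Fin.sum_univ_two, smul_eq_mul,
    mul_ite, mul_one, mul_zero]
  rw [Finset.sum_add_distrib]
  simp

theorem weight_mdeg_single {n : ℕ} (v : Fin n × Fin 2) :
    Finsupp.weight mdeg (Finsupp.single v 1) = Finsupp.single v.1 1 := by
  rw [Finsupp.weight_single, one_smul, mdeg]

theorem mem_support_weight_mdeg {n : ℕ} {d : Fin n × Fin 2 →₀ ℕ} {i : Fin n} :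
    i ∈ (Finsupp.weight mdeg d).support ↔ ∃ e : Fin 2, d (i, e) ≠ 0 := by
  rw [Finsupp.mem_support_iff, weight_mdeg_apply, Fin.exists_fin_two]
  omega

variable (K) in
/-- The minor `xᵢyⱼ - xⱼyᵢ`. -/
noncomputable def minor (i j : Fin n) : MvPolynomial (Fin n × Fin 2) K :=
  X (i, 0) * X (j, 1) - X (j, 0) * X (i, 1)

theorem isWeightedHomogeneous_X_mdeg (v : Fin n × Fin 2) :
    IsWeightedHomogeneous mdeg (X v : MvPolynomial (Fin n × Fin 2) K) (Finsupp.single v.1 1) :=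
  isWeightedHomogeneous_X K mdeg v

theorem isWeightedHomogeneous_minor (i j : Fin n) :
    IsWeightedHomogeneous mdeg (minor K i j) (Finsupp.single i 1 + Finsupp.single j 1) := by
  refine IsWeightedHomogeneous.sub (R := K) ?_ ?_
  · exact (isWeightedHomogeneous_X_mdeg (i, 0)).mul (isWeightedHomogeneous_X_mdeg (j, 1))
  · rw [add_comm]
    exact (isWeightedHomogeneous_X_mdeg (j, 0)).mul (isWeightedHomogeneous_X_mdeg (i, 1))

theorem minor_mem {G : SimpleGraph (Fin n)} {i j : Fin n} (h : G.Adj i j) :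
    minor K i j ∈ binomialEdgeIdeal K G :=
  Ideal.subset_span ⟨i, j, h, rfl⟩

theorem binomialEdgeIdeal_induction {G : SimpleGraph (Fin n)}
    {p : MvPolynomial (Fin n × Fin 2) K → Prop} (zero : p 0)
    (add : ∀ f g, p f → p g → p (f + g))
    (mul : ∀ i j, G.Adj i j → ∀ d c, p (monomial d c * minor K i j))
    {f : MvPolynomial (Fin n × Fin 2) K} (hf : f ∈ binomialEdgeIdeal K G) : p f := by
  suffices ∀ r : MvPolynomial (Fin n × Fin 2) K, p (r * f) by simpa using this 1
  refine Submodule.span_induction (p := fun f _ => ∀ r : MvPolynomial (Fin n × Fin 2) K, p (r * f))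
    ?_ ?_ ?_ ?_ hf
  · rintro _ ⟨i, j, h, rfl⟩ r
    induction r using MvPolynomial.induction_on' with
    | monomial d c => exact mul i j h d c
    | add r s hr hs => rw [add_mul]; exact add _ _ hr hs
  · intro r; rwa [mul_zero]
  · intro f g _ _ hf hg r
    rw [mul_add]; exact add _ _ (hf r) (hg r)
  · intro a f _ hf r
    rw [smul_eq_mul, ← mul_assoc]; exact hf _

theorem weightedHomogeneousComponent_of_isWeightedHomogeneous {σ : Type*} {M : Type*}
    [AddCommMonoid M] {wt : σ → M} {f : MvPolynomial σ K} {b : M}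
    (hf : IsWeightedHomogeneous wt f b) (a : M) [Decidable (b = a)] :
    weightedHomogeneousComponent wt a f = if b = a then f else 0 := by
  split_ifs with h
  · subst h; exact hf.weightedHomogeneousComponent_same
  · exact hf.weightedHomogeneousComponent_ne a (Ne.symm h)

theorem isMultigraded_binomialEdgeIdeal (G : SimpleGraph (Fin n)) :
    IsMultigraded (binomialEdgeIdeal K G) := by
  classical
  intro f hf a
  refine binomialEdgeIdeal_induction
    (p := fun f => weightedHomogeneousComponent mdeg a f ∈ binomialEdgeIdeal K G) ?_ ?_ ?_ hf
  · rw [map_zero]; exact zero_mem _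
  · intro f g hf hg
    rw [map_add]; exact add_mem hf hg
  · intro i j h d c
    rw [weightedHomogeneousComponent_of_isWeightedHomogeneous
      ((isWeightedHomogeneous_monomial mdeg d c rfl).mul (isWeightedHomogeneous_minor i j))]
    split_ifs
    · exact Ideal.mul_mem_left _ _ (minor_mem h)
    · exact zero_mem _

/-! ### Minors of pairs joined inside the support -/

/-- The edges of `G` with both ends in `T`. -/
def restrict (G : SimpleGraph (Fin n)) (T : Finset (Fin n)) : SimpleGraph (Fin n) where
  Adj i j := G.Adj i j ∧ i ∈ T ∧ j ∈ T
  symm := ⟨fun _ _ h => ⟨h.1.symm, h.2.2, h.2.1⟩⟩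
  loopless := ⟨fun _ h => h.1.ne rfl⟩

theorem restrict_mono_right (G : SimpleGraph (Fin n)) {T U : Finset (Fin n)} (h : T ⊆ U) :
    restrict G T ≤ restrict G U := fun _ _ hij => ⟨hij.1, h hij.2.1, h hij.2.2⟩

theorem monomial_eq_X_mul {σ : Type*} {d : σ →₀ ℕ} {v : σ} (h : d v ≠ 0) (c : K) :
    monomial d c = X v * monomial (d - Finsupp.single v 1) c := by
  rw [X, monomial_mul, one_mul, add_tsub_cancel_of_le]
  simpa [Finsupp.single_le_iff] using Nat.one_le_iff_ne_zero.2 h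

/-- For a walk $i,k,\dots,j$ the relation $x_k[ij]=x_i[kj]+x_j[ik]$, valid also with $y$ in place of
the coefficients $x$, trades a variable of $k$ for one of $i$. The new monomial still involves every
vertex of $T$ other than $k$ and $j$, as the rest of the walk requires. -/
theorem monomial_mul_minor_mem {G : SimpleGraph (Fin n)} {T : Finset (Fin n)} {i j : Fin n}
    (p : (restrict G T).Walk i j) : ∀ (d : Fin n × Fin 2 →₀ ℕ) (c : K),
      (∀ t ∈ T, t ≠ i → t ≠ j → t ∈ (Finsupp.weight mdeg d).support) →
        monomial d c * minor K i j ∈ binomialEdgeIdeal K G := by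
  induction p with
  | nil => intro d c _; simp [minor, mul_comm]
  | @cons i k j hik p ih =>
    intro d c hd
    by_cases hkj : k = j
    · subst hkj
      exact Ideal.mul_mem_left _ _ (minor_mem hik.1)
    by_cases hij : i = j
    · subst hij; simp [minor, mul_comm]
    obtain ⟨e, he⟩ := mem_support_weight_mdeg.1 (hd k hik.2.2 hik.1.ne' hkj)
    set d' := d - Finsupp.single (k, e) 1 with hd'
    have h1 := ih (d' + Finsupp.single (i, e) 1) c (fun t ht htk htj => by
      rw [mem_support_weight_mdeg]
      by_cases hti : t = i
      · exact ⟨e, by simp [hti]⟩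
      · obtain ⟨e', he'⟩ := mem_support_weight_mdeg.1 (hd t ht hti htj)
        refine ⟨e', ?_⟩
        have : ¬ (k = t) := fun h => htk h.symm
        simpa [hd', Finsupp.single_apply, this, hti] using he')
    have h2 : monomial d' c * X (j, e) * minor K i k ∈ binomialEdgeIdeal K G :=
      Ideal.mul_mem_left _ _ (minor_mem hik.1)
    rw [monomial_eq_X_mul he]
    rw [show monomial (d' + Finsupp.single (i, e) 1) c = monomial d' c * X (i, e) by
      rw [X, monomial_mul, mul_one]] at h1
    convert add_mem h1 h2 using 1
    simp only [minor, ← hd']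
    fin_cases e <;> simp <;> ring

theorem mul_minor_mem {G : SimpleGraph (Fin n)} {a b : Fin n →₀ ℕ} {i j : Fin n}
    {f : MvPolynomial (Fin n × Fin 2) K} (hf : IsWeightedHomogeneous mdeg f b)
    (ha : b + Finsupp.single i 1 + Finsupp.single j 1 = a)
    (h : (restrict G a.support).Reachable i j) :
    f * minor K i j ∈ binomialEdgeIdeal K G := by
  obtain ⟨p⟩ := h
  rw [f.as_sum, Finset.sum_mul]
  refine sum_mem fun d hd => monomial_mul_minor_mem p d _ fun t ht hti htj => ?_
  rw [hf (mem_support_iff.1 hd)]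
  rw [← ha] at ht
  simpa [Finsupp.single_apply, Ne.symm hti, Ne.symm htj] using ht

/-! ### Changes of coordinates -/

theorem coordChange_X (g : Fin n → GL (Fin 2) K) (v : Fin n × Fin 2) :
    coordChange g (X v) =
      ∑ k : Fin 2, C ((g v.1 : Matrix (Fin 2) (Fin 2) K) k v.2) * X (v.1, k) := by
  rw [coordChange, aeval_X]

theorem coordChange_coordChange (g h : Fin n → GL (Fin 2) K)
    (f : MvPolynomial (Fin n × Fin 2) K) :
    coordChange g (coordChange h f) = coordChange (g * h) f := by
  suffices (coordChange g).comp (coordChange h) = coordChange (g * h) from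
    DFunLike.congr_fun this f
  refine MvPolynomial.algHom_ext fun v => ?_
  simp only [AlgHom.comp_apply, coordChange_X, map_mul, Fin.sum_univ_two, algHom_C,
    algebraMap_eq, Pi.mul_apply, Units.val_mul, Matrix.mul_apply, map_add]
  ring

theorem coordChange_one (f : MvPolynomial (Fin n × Fin 2) K) : coordChange 1 f = f := by
  suffices coordChange (1 : Fin n → GL (Fin 2) K) = AlgHom.id K _ by rw [this]; rfl
  refine MvPolynomial.algHom_ext fun ⟨i, e⟩ => ?_
  rw [coordChange_X]
  fin_cases e <;> simp

theorem coordChange_inv_coordChange (g : Fin n → GL (Fin 2) K)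
    (f : MvPolynomial (Fin n × Fin 2) K) : coordChange g⁻¹ (coordChange g f) = f := by
  rw [coordChange_coordChange, inv_mul_cancel, coordChange_one]

theorem coordChange_coordChange_inv (g : Fin n → GL (Fin 2) K)
    (f : MvPolynomial (Fin n × Fin 2) K) : coordChange g (coordChange g⁻¹ f) = f := by
  rw [coordChange_coordChange, mul_inv_cancel, coordChange_one]

theorem mem_map_coordChange {g : Fin n → GL (Fin 2) K}
    {I : Ideal (MvPolynomial (Fin n × Fin 2) K)} {f : MvPolynomial (Fin n × Fin 2) K} :
    f ∈ I.map (coordChange g) ↔ coordChange g⁻¹ f ∈ I := by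
  constructor
  · intro hf
    have : I.map (coordChange g) ≤ I.comap (coordChange g⁻¹) :=
      Ideal.map_le_iff_le_comap.2 fun p hp => by
        rw [Ideal.mem_comap, Ideal.mem_comap, coordChange_inv_coordChange]; exact hp
    exact this hf
  · intro hf
    rw [← coordChange_coordChange_inv g f]
    exact Ideal.mem_map_of_mem _ hf

theorem isWeightedHomogeneous_coordChange_X (g : Fin n → GL (Fin 2) K) (v : Fin n × Fin 2) :
    IsWeightedHomogeneous mdeg (coordChange g (X v)) (Finsupp.single v.1 1) := by
  rw [coordChange_X]
  exact IsWeightedHomogeneous.sum _ _ _ fun k _ =>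
    (isWeightedHomogeneous_X_mdeg (v.1, k)).C_mul _

theorem isWeightedHomogeneous_coordChange_monomial (g : Fin n → GL (Fin 2) K)
    (d : Fin n × Fin 2 →₀ ℕ) (c : K) :
    IsWeightedHomogeneous mdeg (coordChange g (monomial d c)) (Finsupp.weight mdeg d) := by
  rw [monomial_eq, map_mul, Finsupp.prod, map_prod, algHom_C, algebraMap_eq]
  refine IsWeightedHomogeneous.C_mul ?_ _
  rw [Finsupp.weight_apply, Finsupp.sum]
  refine IsWeightedHomogeneous.prod _ _ _ fun v _ => ?_
  rw [map_pow]
  exact (isWeightedHomogeneous_coordChange_X g v).pow _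

theorem isWeightedHomogeneous_coordChange (g : Fin n → GL (Fin 2) K)
    {f : MvPolynomial (Fin n × Fin 2) K} {a : Fin n →₀ ℕ} (hf : IsWeightedHomogeneous mdeg f a) :
    IsWeightedHomogeneous mdeg (coordChange g f) a := by
  rw [f.as_sum, map_sum]
  refine IsWeightedHomogeneous.sum _ _ _ fun d hd => ?_
  rw [← hf (mem_support_iff.1 hd)]
  exact isWeightedHomogeneous_coordChange_monomial g d _

theorem weightedHomogeneousComponent_coordChange (g : Fin n → GL (Fin 2) K)
    (f : MvPolynomial (Fin n × Fin 2) K) (a : Fin n →₀ ℕ) :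
    weightedHomogeneousComponent mdeg a (coordChange g f) =
      coordChange g (weightedHomogeneousComponent mdeg a f) := by
  classical
  induction f using MvPolynomial.induction_on' with
  | monomial d c =>
    rw [weightedHomogeneousComponent_of_isWeightedHomogeneous
        (isWeightedHomogeneous_coordChange_monomial g d c),
      weightedHomogeneousComponent_of_isWeightedHomogeneous
        (isWeightedHomogeneous_monomial mdeg d c rfl)]
    split_ifs <;> simp
  | add f f' hf hf' => simp only [map_add, hf, hf']

theorem IsMultigraded.map_coordChange {I : Ideal (MvPolynomial (Fin n × Fin 2) K)}
    (hI : IsMultigraded I) (g : Fin n → GL (Fin 2) K) :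
    IsMultigraded (I.map (coordChange g)) := by
  intro f hf a
  rw [mem_map_coordChange] at hf ⊢
  rw [← weightedHomogeneousComponent_coordChange]
  exact hI _ hf a

/-! ### Counting -/

section Counting

open Classical in
-- On a component $C$ let $i$ be the `lt`-largest vertex with $d(i,z_i)\ne0$. The hypotheses then
-- force $d(j,z_j)=a_j$ for the smaller $j$ with `par i j`, and $d(j,z_j)=0$ for all other $j\ne i$.
-- So $d$ on $C$ is encoded by $i$ and a value in $\{1,\dots,a_i\}$, or by the absence of such an
-- $i$: this makes $1+\sum_{i\in C}a_i$ cases. In the application $z_i$ selects the larger variable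
-- at $i$, and `par` says that the product of the two larger variables is missing from the
-- transformed minor.
theorem card_le_of_standard {Q : Type*} [Fintype Q] (r : Fin n → Q) (a : Fin n →₀ ℕ)
    (z : Fin n → Fin 2) (par lt : Fin n → Fin n → Prop) [IsTrans (Fin n) lt]
    [Std.Irrefl lt] (hlt : ∀ i j, i ≠ j → lt i j ∨ lt j i)
    (S : Finset (Fin n × Fin 2 →₀ ℕ)) (hS : ∀ d ∈ S, Finsupp.weight mdeg d = a)
    (h1 : ∀ d ∈ S, ∀ i j, i ≠ j → r i = r j → ¬ par i j → d (i, z i) = 0 ∨ d (j, z j) = 0)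
    (h2 : ∀ d ∈ S, ∀ i j, r i = r j → par i j → lt j i →
      d (i, z i) = 0 ∨ d (j, 1 - z j) = 0) :
    S.card ≤ ∏ C : Q, ((∑ i : {i // r i = C}, a i) + 1) := by
  let τ := ∀ C : Q, Option (Σ i : {i // r i = C}, Fin (a i))
  let β : τ → Fin n → ℕ := fun t i => (t (r i)).elim 0 fun p =>
    if p.1.1 = i then p.2 + 1 else if par p.1 i ∧ lt i p.1 then a i else 0
  let D : τ → (Fin n × Fin 2 →₀ ℕ) := fun t => Finsupp.equivFunOnFinite.symm fun v =>
    if v.2 = z v.1 then β t v.1 else a v.1 - β t v.1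
  have hcard : Fintype.card τ = ∏ C : Q, ((∑ i : {i // r i = C}, a i) + 1) := by
    simp [τ, Fintype.card_pi, Fintype.card_option, Fintype.card_sigma]
  rw [← hcard, ← Finset.card_univ]
  refine Finset.card_le_card_of_surjOn D fun d hd => ?_
  have hd : d ∈ S := hd
  have hsum : ∀ i, d (i, z i) + d (i, 1 - z i) = a i := fun i => by
    rw [← hS d hd, weight_mdeg_apply]
    rcases Fin.exists_fin_two.1 ⟨z i, rfl⟩ with h | h <;> rw [h]
    · rfl
    · rw [add_comm]; rfl
  have key : ∀ C : Q, ∃ t : Option (Σ i : {i // r i = C}, Fin (a i)), ∀ i, r i = C →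
      (t.elim 0 fun p => if p.1.1 = i then p.2.1 + 1 else if par p.1 i ∧ lt i p.1 then a i else 0)
        = d (i, z i) := by
    intro C
    by_cases hC : ∃ i, r i = C ∧ d (i, z i) ≠ 0
    -- A minimal element for the swapped relation is a largest one for `lt`.
    · obtain ⟨i, ⟨hi, hdi⟩, hmax⟩ :=
        (Finite.wellFounded_of_trans_of_irrefl (Function.swap lt)).has_min
          {i | r i = C ∧ d (i, z i) ≠ 0} hC
      have hle := hsum i
      refine ⟨some ⟨⟨i, hi⟩, ⟨d (i, z i) - 1, by
        change d (i, z i) - 1 < a i; have : d (i, z i) ≠ 0 := hdi; omega⟩⟩, fun j hj => ?_⟩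
      simp only [Option.elim_some]
      split_ifs with hij hp
      · subst hij; omega
      · have := (h2 d hd i j (hi.trans hj.symm) hp.1 hp.2).resolve_left hdi
        have := hsum j
        omega
      · by_contra hne
        have hdj : d (j, z j) ≠ 0 := Ne.symm hne
        have hnl : ¬ lt i j := hmax j ⟨hj, hdj⟩
        refine hp ⟨?_, (hlt i j hij).resolve_left hnl⟩
        by_contra hpar
        exact (h1 d hd i j hij (hi.trans hj.symm) hpar).elim hdi hdj
    · push Not at hC
      exact ⟨none, fun i hi => (hC i hi).symm⟩
  choose t ht using key
  refine ⟨t, Finset.mem_coe.2 (Finset.mem_univ _), ?_⟩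
  have hβ : ∀ i, β t i = d (i, z i) := fun i => ht (r i) i rfl
  ext ⟨i, e⟩
  simp only [D, Finsupp.equivFunOnFinite_symm_apply_apply, hβ]
  split_ifs with h
  · rw [h]
  · have := hsum i
    have he : e = 1 - z i := by
      revert h; generalize z i = y; revert e y; decide
    rw [he]; omega

theorem exists_le_sum_eq {ι : Type*} (s : Finset ι) (a : ι → ℕ) (k : ℕ) (hk : k ≤ ∑ i ∈ s, a i) :
    ∃ b : ι → ℕ, (∀ i, b i ≤ a i) ∧ ∑ i ∈ s, b i = k := by
  classical
  induction s using Finset.induction_on generalizing k with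
  | empty => exact ⟨fun _ => 0, fun _ => Nat.zero_le _, by simpa [eq_comm] using hk⟩
  | insert i s hi ih =>
    rw [Finset.sum_insert hi] at hk
    obtain ⟨b, hb, hs⟩ := ih (k - min k (a i)) (by omega)
    refine ⟨Function.update b i (min k (a i)), fun j => ?_, ?_⟩
    · by_cases hj : j = i
      · subst hj; simp
      · simpa [hj] using hb j
    · rw [Finset.sum_insert hi, Function.update_self, Finset.sum_congr rfl (g := b), hs]
      · omega
      · intro j hj
        exact Function.update_of_ne (ne_of_mem_of_not_mem hj hi) _ _

open Classical in
theorem exists_le_fiber_sum_eq {Q : Type*} (r : Fin n → Q) (a : Fin n → ℕ)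
    (k : Q → ℕ) (hk : ∀ C, k C ≤ ∑ i : {i // r i = C}, a i) :
    ∃ b : Fin n → ℕ, (∀ i, b i ≤ a i) ∧ ∀ C, ∑ i : {i // r i = C}, b i = k C := by
  choose b hb hs using fun C =>
    exists_le_sum_eq (Finset.univ : Finset {i // r i = C}) (fun i => a i) (k C) (hk C)
  refine ⟨fun i => b (r i) ⟨i, rfl⟩, fun i => hb _ _, fun C => ?_⟩
  rw [← hs C]
  refine Finset.sum_congr rfl fun i _ => ?_
  obtain ⟨i, rfl⟩ := i
  rfl

theorem finite_weight_mdeg_eq (a : Fin n →₀ ℕ) :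
    {d : Fin n × Fin 2 →₀ ℕ | Finsupp.weight mdeg d = a}.Finite := by
  refine (Set.finite_Iic (Finsupp.equivFunOnFinite.symm fun v : Fin n × Fin 2 => a v.1)).subset ?_
  rintro d rfl ⟨i, e⟩
  rw [Finsupp.equivFunOnFinite_symm_apply_apply, weight_mdeg_apply]
  revert e
  rw [Fin.forall_fin_two]
  exact ⟨Nat.le_add_right _ _, Nat.le_add_left _ _⟩

/-- The exponent vectors of multidegree `a`. -/
noncomputable def exponents (a : Fin n →₀ ℕ) : Finset (Fin n × Fin 2 →₀ ℕ) :=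
  (finite_weight_mdeg_eq a).toFinset

theorem mem_exponents {a : Fin n →₀ ℕ} {d : Fin n × Fin 2 →₀ ℕ} :
    d ∈ exponents a ↔ Finsupp.weight mdeg d = a := by
  simp [exponents]

end Counting

/-! ### The collapsing homomorphisms -/

open Classical in
/-- The homomorphism identifying the pairs of variables within each connected component of the
graph induced on `T`, and killing the variables outside of `T`. -/
noncomputable def collapse (K : Type u) [Field K] (G : SimpleGraph (Fin n)) (T : Finset (Fin n)) :
    MvPolynomial (Fin n × Fin 2) K →ₐ[K]
      MvPolynomial ((restrict G T).ConnectedComponent × Fin 2) K :=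
  aeval fun v => if v.1 ∈ T then X ((restrict G T).connectedComponentMk v.1, v.2) else 0

theorem collapse_eq_zero_of_mem {G : SimpleGraph (Fin n)} (T : Finset (Fin n))
    {f : MvPolynomial (Fin n × Fin 2) K} (hf : f ∈ binomialEdgeIdeal K G) :
    collapse K G T f = 0 := by
  suffices binomialEdgeIdeal K G ≤ RingHom.ker (collapse K G T) from this hf
  refine Ideal.span_le.2 ?_
  rintro _ ⟨i, j, hij, rfl⟩
  simp only [SetLike.mem_coe, RingHom.mem_ker, collapse, map_sub, map_mul, aeval_X]
  by_cases hi : i ∈ T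
  · by_cases hj : j ∈ T
    · have h : (restrict G T).connectedComponentMk i = (restrict G T).connectedComponentMk j :=
        SimpleGraph.ConnectedComponent.eq.2 (SimpleGraph.Adj.reachable ⟨hij, hi, hj⟩)
      simp [hi, hj, h]
    · simp [hj]
  · simp [hi]

theorem collapse_monomial (G : SimpleGraph (Fin n)) {T : Finset (Fin n)}
    {d : Fin n × Fin 2 →₀ ℕ} (hd : (Finsupp.weight mdeg d).support ⊆ T) (c : K) :
    collapse K G T (monomial d c) =
      monomial (d.mapDomain fun v => ((restrict G T).connectedComponentMk v.1, v.2)) c := by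
  rw [← rename_monomial, monomial_eq, map_mul, map_mul, algHom_C, algHom_C, Finsupp.prod,
    map_prod, map_prod]
  congr 1
  refine Finset.prod_congr rfl fun v hv => ?_
  have : v.1 ∈ T := hd (mem_support_weight_mdeg.2 ⟨v.2, Finsupp.mem_support_iff.1 hv⟩)
  simp [collapse, this]

open Classical in
/-- The dimension of the degree `a` part of `K[x,y] / J_G`. -/
noncomputable def standardCount (G : SimpleGraph (Fin n)) (a : Fin n →₀ ℕ) : ℕ :=
  ∏ C : (restrict G a.support).ConnectedComponent,
    ((∑ i : {i // (restrict G a.support).connectedComponentMk i = C}, a i) + 1)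

/-- A spanning family that is no larger than an independent family in its span is itself independent
and of the same size. -/
theorem linearIndependent_of_mem_span {ι σ E : Type*} [Fintype ι] [Fintype σ] [AddCommGroup E]
    [Module K E] {u : ι → E} {v : σ → E} (hu : LinearIndependent K u)
    (h : ∀ i, u i ∈ Submodule.span K (Set.range v)) (hc : Fintype.card σ ≤ Fintype.card ι) :
    LinearIndependent K v ∧ Fintype.card σ = Fintype.card ι := by
  have hle : Submodule.span K (Set.range u) ≤ Submodule.span K (Set.range v) := by
    rw [Submodule.span_le]; rintro _ ⟨i, rfl⟩; exact h i
  have : FiniteDimensional K (Submodule.span K (Set.range v)) :=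
    FiniteDimensional.span_of_finite K (Set.finite_range v)
  have h1 := Submodule.finrank_mono hle
  rw [finrank_span_eq_card hu] at h1
  have h2 : Module.finrank K (Submodule.span K (Set.range v)) ≤ Fintype.card σ :=
    finrank_range_le_card v
  exact ⟨linearIndependent_iff_card_le_finrank_span.2 (hc.trans h1), by omega⟩

open Classical in
-- For each prescription of the total $x$-degree on every component, pick one monomial of
-- multidegree $a$ realizing it. Collapsing sends these monomials to distinct monomials.
theorem exists_linearIndependent_collapse (G : SimpleGraph (Fin n)) (a : Fin n →₀ ℕ) :
    ∃ d : (∀ C : (restrict G a.support).ConnectedComponent,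
        Fin ((∑ i : {i // (restrict G a.support).connectedComponentMk i = C}, a i) + 1)) →
          Fin n × Fin 2 →₀ ℕ, (∀ k, Finsupp.weight mdeg (d k) = a) ∧
        LinearIndependent K fun k => collapse K G a.support (monomial (d k) 1) := by
  choose b hb hs using fun k : (∀ C : (restrict G a.support).ConnectedComponent,
        Fin ((∑ i : {i // (restrict G a.support).connectedComponentMk i = C}, a i) + 1)) =>
    exists_le_fiber_sum_eq (restrict G a.support).connectedComponentMk a (fun C => (k C).1)
      fun C => Nat.lt_succ_iff.1 (k C).2
  let d k : Fin n × Fin 2 →₀ ℕ := Finsupp.equivFunOnFinite.symm fun v =>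
    if v.2 = 0 then b k v.1 else a v.1 - b k v.1
  have hd : ∀ k, Finsupp.weight mdeg (d k) = a := fun k => by
    ext i
    rw [weight_mdeg_apply]
    have := hb k i
    simp only [d, Finsupp.equivFunOnFinite_symm_apply_apply]
    simp; omega
  refine ⟨d, hd, ?_⟩
  have : (fun k => collapse K G a.support (monomial (d k) 1)) = basisMonomials _ K ∘
      fun k => (d k).mapDomain
        fun v => ((restrict G a.support).connectedComponentMk v.1, v.2) := by
    funext k
    rw [collapse_monomial G (by rw [hd k]), Function.comp, coe_basisMonomials]
  rw [this]
  refine (basisMonomials _ K).linearIndependent.comp _ fun k k' hkk' => ?_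
  have hval : ∀ k C, ((d k).mapDomain
      fun v => ((restrict G a.support).connectedComponentMk v.1, v.2)) (C, 0) = (k C).1 := by
    intro k C
    rw [← hs k C, Finsupp.mapDomain, Finsupp.sum_fintype _ _ (by simp), Finsupp.finsetSum_apply,
      Fintype.sum_prod_type]
    simp only [Finsupp.single_apply, Fin.sum_univ_two, Prod.mk.injEq, d,
      Finsupp.equivFunOnFinite_symm_apply_apply]
    simp only [and_true, if_true, one_ne_zero, and_false, if_false, add_zero]
    rw [← Finset.sum_filter, Finset.sum_subtype]
    simp
  funext C
  apply Fin.ext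
  rw [← hval k C, ← hval k' C]
  exact DFunLike.congr_fun hkk' (C, 0)

/-! ### The leading monomials of the transformed minors -/

/-- The coefficient of `(i, s) (j, t)` in the transform of the minor `xᵢyⱼ - xⱼyᵢ`. -/
def minorCoeff (g : Fin n → GL (Fin 2) K) (i j : Fin n) (s t : Fin 2) : K :=
  (g i : Matrix (Fin 2) (Fin 2) K) s 0 * (g j : Matrix (Fin 2) (Fin 2) K) t 1 -
    (g j : Matrix (Fin 2) (Fin 2) K) t 0 * (g i : Matrix (Fin 2) (Fin 2) K) s 1

/-- The exponent of `(i, s) (j, t)`. -/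
noncomputable def pairExp (i j : Fin n) (s t : Fin 2) : Fin n × Fin 2 →₀ ℕ :=
  Finsupp.single (i, s) 1 + Finsupp.single (j, t) 1

theorem pairExp_inj {i j : Fin n} (hij : i ≠ j) {s t s' t' : Fin 2} :
    pairExp i j s t = pairExp i j s' t' ↔ s = s' ∧ t = t' := by
  refine ⟨fun h => ?_, by rintro ⟨rfl, rfl⟩; rfl⟩
  have h1 := DFunLike.congr_fun h (i, s)
  have h2 := DFunLike.congr_fun h (j, t)
  simp only [pairExp, Finsupp.add_apply, Finsupp.single_apply, Prod.mk.injEq, hij, hij.symm,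
    true_and, false_and, if_true, if_false] at h1 h2
  constructor
  · by_contra hs; simp [Ne.symm hs] at h1
  · by_contra hs; simp [Ne.symm hs] at h2

theorem pairExp_le_iff {i j : Fin n} (hij : i ≠ j) {s t : Fin 2} {d : Fin n × Fin 2 →₀ ℕ} :
    pairExp i j s t ≤ d ↔ d (i, s) ≠ 0 ∧ d (j, t) ≠ 0 := by
  constructor
  · intro h
    have h1 := h (i, s)
    have h2 := h (j, t)
    simp [pairExp, hij, hij.symm] at h1 h2
    omega
  · rintro ⟨h1, h2⟩ v
    simp only [pairExp, Finsupp.add_apply, Finsupp.single_apply]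
    split_ifs with h h' h'
    · rw [← h'] at h; exact absurd (congrArg Prod.fst h) hij
    · subst h; omega
    · subst h'; omega
    · omega

theorem weight_pairExp (i j : Fin n) (s t : Fin 2) :
    Finsupp.weight mdeg (pairExp i j s t) = Finsupp.single i 1 + Finsupp.single j 1 := by
  rw [pairExp, map_add, weight_mdeg_single, weight_mdeg_single]

theorem coordChange_minor (g : Fin n → GL (Fin 2) K) (i j : Fin n) :
    coordChange g (minor K i j) =
      ∑ s : Fin 2, ∑ t : Fin 2, monomial (pairExp i j s t) (minorCoeff g i j s t) := by
  have h : ∀ s t (c : K), monomial (pairExp i j s t) c = C c * (X (i, s) * X (j, t)) := by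
    intro s t c
    rw [X, X, monomial_mul, C_mul_monomial, pairExp, mul_one, mul_one]
  simp only [h, minor, map_sub, map_mul, coordChange_X, Fin.sum_univ_two, minorCoeff]
  ring

theorem coeff_coordChange_minor (g : Fin n → GL (Fin 2) K) {i j : Fin n} (hij : i ≠ j)
    (s t : Fin 2) :
    coeff (pairExp i j s t) (coordChange g (minor K i j)) = minorCoeff g i j s t := by
  rw [coordChange_minor]
  simp only [coeff_sum, coeff_monomial, pairExp_inj hij]
  fin_cases s <;> fin_cases t <;> simp

theorem exists_of_mem_support_coordChange_minor {g : Fin n → GL (Fin 2) K} {i j : Fin n}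
    (hij : i ≠ j) {d : Fin n × Fin 2 →₀ ℕ} (hd : d ∈ (coordChange g (minor K i j)).support) :
    ∃ s t, d = pairExp i j s t ∧ minorCoeff g i j s t ≠ 0 := by
  have h := mem_support_iff.1 hd
  have : ∃ s t, d = pairExp i j s t := by
    by_contra! hne
    apply h
    rw [coordChange_minor]
    simp only [coeff_sum, coeff_monomial]
    exact Finset.sum_eq_zero fun s _ => Finset.sum_eq_zero fun t _ =>
      if_neg (hne s t).symm
  obtain ⟨s, t, rfl⟩ := this
  exact ⟨s, t, rfl, by rwa [coeff_coordChange_minor g hij] at h⟩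

theorem det_ne_zero (A : GL (Fin 2) K) : A.1 0 0 * A.1 1 1 - A.1 0 1 * A.1 1 0 ≠ 0 := by
  rw [← Matrix.det_fin_two]
  exact (Matrix.isUnits_det_units A).ne_zero

/-- The coefficients form the matrix $g_i\varepsilon g_j^{T}$ with $\varepsilon$ the standard
alternating matrix. It is invertible, so no column vanishes. -/
theorem minorCoeff_left_ne_zero (g : Fin n → GL (Fin 2) K) {i j : Fin n} {s t : Fin 2}
    (h : minorCoeff g i j s t = 0) : minorCoeff g i j (1 - s) t ≠ 0 := by
  intro h'
  have hi := det_ne_zero (g i)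
  have hj := det_ne_zero (g j)
  have h0 : minorCoeff g i j 0 t = 0 ∧ minorCoeff g i j 1 t = 0 := by
    fin_cases s
    · exact ⟨h, h'⟩
    · exact ⟨h', h⟩
  obtain ⟨h0, h1⟩ := h0
  simp only [minorCoeff] at h0 h1
  -- The two equations are a linear system for row $t$ of $g_j$ with determinant $\pm\det g_i$, so
  -- that row would be zero.
  have ht1 : (g j).1 t 1 = 0 := by
    refine (mul_eq_zero.1 ?_).resolve_left hi
    linear_combination (g i).1 1 1 * h0 - (g i).1 0 1 * h1
  have ht0 : (g j).1 t 0 = 0 := by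
    refine (mul_eq_zero.1 ?_).resolve_left hi
    linear_combination (g i).1 1 0 * h0 - (g i).1 0 0 * h1
  apply hj
  fin_cases t
  · simp only [Fin.zero_eta] at ht0 ht1; simp [ht0, ht1]
  · simp only [Fin.mk_one] at ht0 ht1; simp [ht0, ht1]

theorem minorCoeff_comm (g : Fin n → GL (Fin 2) K) (i j : Fin n) (s t : Fin 2) :
    minorCoeff g i j s t = -minorCoeff g j i t s := by
  simp only [minorCoeff]; ring

theorem minorCoeff_right_ne_zero (g : Fin n → GL (Fin 2) K) {i j : Fin n} {s t : Fin 2}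
    (h : minorCoeff g i j s t = 0) : minorCoeff g i j s (1 - t) ≠ 0 := by
  rw [minorCoeff_comm, neg_eq_zero] at h
  rw [minorCoeff_comm, neg_ne_zero]
  exact minorCoeff_left_ne_zero g h

theorem coordChange_minor_ne_zero (g : Fin n → GL (Fin 2) K) {i j : Fin n} (hij : i ≠ j) :
    coordChange g (minor K i j) ≠ 0 := by
  intro h
  have h0 := coeff_coordChange_minor g hij 0 0
  have h1 := coeff_coordChange_minor g hij (1 - 0) 0
  rw [h, coeff_zero] at h0 h1
  exact minorCoeff_left_ne_zero g h0.symm h1.symm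

section Order

variable (m : MonomialOrder.{0, w} (Fin n × Fin 2))

/-- The index of the larger one of the variables `xᵢ` and `yᵢ`. -/
noncomputable def bigIdx (i : Fin n) : Fin 2 := by
  classical
  exact if m.toSyn (Finsupp.single (i, 1) 1) < m.toSyn (Finsupp.single (i, 0) 1) then 0 else 1

theorem toSyn_lt_bigIdx (i : Fin n) :
    m.toSyn (Finsupp.single (i, 1 - bigIdx m i) 1) < m.toSyn (Finsupp.single (i, bigIdx m i) 1) := by
  rw [bigIdx]
  split_ifs with h
  · exact h
  · refine lt_of_le_of_ne (not_lt.1 h) fun h' => ?_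
    have := m.toSyn.injective h'
    rw [Finsupp.single_left_inj one_ne_zero] at this
    simp at this

theorem bigIdx_eq_zero {i : Fin n}
    (h : m.toSyn (Finsupp.single (i, 1) 1) < m.toSyn (Finsupp.single (i, 0) 1)) :
    bigIdx m i = 0 := if_pos h

theorem eq_bigIdx_or (i : Fin n) (s : Fin 2) : s = bigIdx m i ∨ s = 1 - bigIdx m i := by
  generalize bigIdx m i = t; revert s t; decide

/-- The vertex `i` is smaller than `j` if the ratio of the larger to the smaller variable is. -/
def ratioLT (i j : Fin n) : Prop :=
  m.toSyn (pairExp j i (1 - bigIdx m j) (bigIdx m i)) <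
    m.toSyn (pairExp j i (bigIdx m j) (1 - bigIdx m i))

instance : IsTrans (Fin n) (ratioLT m) where
  trans i j k hij hjk := by
    simp only [ratioLT, pairExp, map_add] at hij hjk ⊢
    have := add_lt_add hij hjk
    generalize m.toSyn (Finsupp.single (i, 1 - bigIdx m i) 1) = a at *
    generalize m.toSyn (Finsupp.single (i, bigIdx m i) 1) = a' at *
    generalize m.toSyn (Finsupp.single (j, 1 - bigIdx m j) 1) = b at *
    generalize m.toSyn (Finsupp.single (j, bigIdx m j) 1) = b' at *
    generalize m.toSyn (Finsupp.single (k, 1 - bigIdx m k) 1) = c at *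
    generalize m.toSyn (Finsupp.single (k, bigIdx m k) 1) = c' at *
    -- Multiplying the two inequalities between ratios leaves a common factor, the product of both
    -- variables of $j$.
    refine lt_of_add_lt_add_left (a := b + b') ?_
    convert this using 1 <;> abel

instance : Std.Irrefl (ratioLT m) where
  irrefl i h := by
    simp only [ratioLT, pairExp] at h
    rw [add_comm] at h
    exact lt_irrefl _ h

theorem ratioLT_or (i j : Fin n) (hij : i ≠ j) : ratioLT m i j ∨ ratioLT m j i := by
  have h : m.toSyn (pairExp j i (1 - bigIdx m j) (bigIdx m i)) ≠
      m.toSyn (pairExp j i (bigIdx m j) (1 - bigIdx m i)) := fun h => by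
    have := ((pairExp_inj hij.symm).1 (m.toSyn.injective h)).1
    revert this; generalize bigIdx m j = t; revert t; decide
  refine h.lt_or_gt.imp id fun h => ?_
  simp only [ratioLT, pairExp] at h ⊢
  rwa [add_comm, add_comm (Finsupp.single (i, bigIdx m i) 1)]

theorem exists_degree_coordChange_minor (g : Fin n → GL (Fin 2) K) {i j : Fin n} (hij : i ≠ j) :
    ∃ s t, m.degree (coordChange g (minor K i j)) = pairExp i j s t ∧
      minorCoeff g i j s t ≠ 0 :=
  exists_of_mem_support_coordChange_minor hij
    (m.degree_mem_support (coordChange_minor_ne_zero g hij))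

theorem toSyn_pairExp_le_degree {g : Fin n → GL (Fin 2) K} {i j : Fin n} (hij : i ≠ j)
    {s t : Fin 2} (h : minorCoeff g i j s t ≠ 0) :
    m.toSyn (pairExp i j s t) ≤ m.toSyn (m.degree (coordChange g (minor K i j))) :=
  m.le_degree (by rwa [mem_support_iff, coeff_coordChange_minor g hij])

theorem toSyn_single_le_bigIdx (i : Fin n) (s : Fin 2) :
    m.toSyn (Finsupp.single (i, s) 1) ≤ m.toSyn (Finsupp.single (i, bigIdx m i) 1) := by
  rcases eq_bigIdx_or m i s with h | h
  · rw [h]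
  · rw [h]; exact (toSyn_lt_bigIdx m i).le

theorem degree_coordChange_minor_of_ne_zero {g : Fin n → GL (Fin 2) K} {i j : Fin n}
    (hij : i ≠ j) (h : minorCoeff g i j (bigIdx m i) (bigIdx m j) ≠ 0) :
    m.degree (coordChange g (minor K i j)) = pairExp i j (bigIdx m i) (bigIdx m j) := by
  refine m.toSyn.injective (le_antisymm ?_ (toSyn_pairExp_le_degree m hij h))
  obtain ⟨s, t, hd, -⟩ := exists_degree_coordChange_minor m g hij
  rw [hd, pairExp, pairExp, map_add, map_add]
  exact add_le_add (toSyn_single_le_bigIdx m i s) (toSyn_single_le_bigIdx m j t)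

/-- Once the product of both larger variables is missing, the larger variable of $i$ times the
smaller one of $j$ has a nonzero coefficient. It beats the opposite mixed product by the comparison
of ratios, and the product of both smaller variables always. -/
theorem degree_coordChange_minor_of_eq_zero {g : Fin n → GL (Fin 2) K} {i j : Fin n}
    (hij : i ≠ j) (h : minorCoeff g i j (bigIdx m i) (bigIdx m j) = 0) (hlt : ratioLT m j i) :
    m.degree (coordChange g (minor K i j)) = pairExp i j (bigIdx m i) (1 - bigIdx m j) := by
  refine m.toSyn.injective (le_antisymm ?_
    (toSyn_pairExp_le_degree m hij (minorCoeff_right_ne_zero g h)))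
  obtain ⟨s, t, hd, hst⟩ := exists_degree_coordChange_minor m g hij
  rw [hd]
  rcases eq_bigIdx_or m i s with rfl | rfl <;> rcases eq_bigIdx_or m j t with rfl | rfl
  · exact absurd h hst
  · exact le_rfl
  · exact hlt.le
  · rw [pairExp, pairExp, map_add, map_add]
    exact add_le_add (toSyn_single_le_bigIdx m i _) le_rfl

/-- The exponents of the monomials in the initial ideal of `g(J_G)`. -/
def leadSet (G : SimpleGraph (Fin n)) (g : Fin n → GL (Fin 2) K) :
    Set (Fin n × Fin 2 →₀ ℕ) :=
  {d | ∃ i j, i ≠ j ∧ (restrict G (Finsupp.weight mdeg d).support).Reachable i j ∧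
    m.degree (coordChange g (minor K i j)) ≤ d}

/-- The exponents of multidegree `a` outside of `L`. -/
noncomputable def standard (L : Set (Fin n × Fin 2 →₀ ℕ)) (a : Fin n →₀ ℕ) :
    Finset (Fin n × Fin 2 →₀ ℕ) :=
  @Finset.filter _ (fun d => d ∉ L) (Classical.decPred _) (exponents a)

theorem mem_standard {L : Set (Fin n × Fin 2 →₀ ℕ)} {a : Fin n →₀ ℕ}
    {d : Fin n × Fin 2 →₀ ℕ} : d ∈ standard L a ↔ Finsupp.weight mdeg d = a ∧ d ∉ L := by
  simp only [standard, Finset.mem_filter, mem_exponents]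

theorem card_standard_leadSet_le (G : SimpleGraph (Fin n)) (g : Fin n → GL (Fin 2) K)
    (a : Fin n →₀ ℕ) : (standard (leadSet m G g) a).card ≤ standardCount G a := by
  have hle : ∀ d ∈ standard (leadSet m G g) a, ∀ i j, i ≠ j →
      (restrict G a.support).connectedComponentMk i = (restrict G a.support).connectedComponentMk j →
        ¬ m.degree (coordChange g (minor K i j)) ≤ d := by
    intro d hd i j hij hr hle
    obtain ⟨hda, hd'⟩ := mem_standard.1 hd
    subst hda
    exact hd' ⟨i, j, hij, SimpleGraph.ConnectedComponent.eq.1 hr, hle⟩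
  rw [standardCount]
  convert card_le_of_standard (restrict G a.support).connectedComponentMk a (bigIdx m)
    (fun i j => minorCoeff g i j (bigIdx m i) (bigIdx m j) = 0) (ratioLT m) (ratioLT_or m)
    (standard (leadSet m G g) a) (fun d hd => (mem_standard.1 hd).1) ?_ ?_ using 1
  · congr!
  · intro d hd i j hij hr h
    have := hle d hd i j hij hr
    rw [degree_coordChange_minor_of_ne_zero m hij h, pairExp_le_iff hij] at this
    tauto
  · intro d hd i j hr h hlt
    have hij : i ≠ j := by rintro rfl; exact Std.Irrefl.irrefl _ hlt
    have := hle d hd i j hij hr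
    rw [degree_coordChange_minor_of_eq_zero m hij h hlt, pairExp_le_iff hij] at this
    tauto

end Order

/-! ### Gröbner bases -/

theorem sum_monomial_mem {σ : Type*} {N : Submodule K (MvPolynomial σ K)} {f : MvPolynomial σ K}
    (h : ∀ d ∈ f.support, monomial d (1 : K) ∈ N) : f ∈ N := by
  rw [f.as_sum]
  refine sum_mem fun d hd => ?_
  rw [← mul_one (coeff d f), ← smul_eq_mul, ← smul_monomial]
  exact N.smul_mem _ (h d hd)

section Order

variable (m : MonomialOrder.{0, w} (Fin n × Fin 2))

theorem monomial_mul_coordChange_minor_mem {G : SimpleGraph (Fin n)} (g : Fin n → GL (Fin 2) K)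
    {d : Fin n × Fin 2 →₀ ℕ} {i j : Fin n} (hij : i ≠ j)
    (hr : (restrict G (Finsupp.weight mdeg d).support).Reachable i j)
    (hle : m.degree (coordChange g (minor K i j)) ≤ d) :
    monomial (d - m.degree (coordChange g (minor K i j))) 1 * coordChange g (minor K i j) ∈
        (binomialEdgeIdeal K G).map (coordChange g) ∧
      IsWeightedHomogeneous mdeg
        (monomial (d - m.degree (coordChange g (minor K i j))) (1 : K) *
          coordChange g (minor K i j)) (Finsupp.weight mdeg d) ∧
      m.degree (monomial (d - m.degree (coordChange g (minor K i j))) (1 : K) *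
          coordChange g (minor K i j)) = d := by
  obtain ⟨s, t, hd, -⟩ := exists_degree_coordChange_minor m g hij
  have hw : Finsupp.weight mdeg (d - m.degree (coordChange g (minor K i j))) +
      (Finsupp.single i 1 + Finsupp.single j 1) = Finsupp.weight mdeg d := by
    rw [← weight_pairExp i j s t, ← hd, ← map_add, tsub_add_cancel_of_le hle]
  refine ⟨?_, ?_, ?_⟩
  · rw [mem_map_coordChange, map_mul, coordChange_inv_coordChange]
    exact mul_minor_mem (isWeightedHomogeneous_coordChange_monomial g⁻¹ _ _)
      (by rw [add_assoc]; exact hw) hr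
  · rw [← hw]
    exact (isWeightedHomogeneous_monomial mdeg _ _ rfl).mul
      (isWeightedHomogeneous_coordChange g (isWeightedHomogeneous_minor i j))
  · classical
    rw [m.degree_mul (by simp) (coordChange_minor_ne_zero g hij), m.degree_monomial,
      if_neg one_ne_zero, tsub_add_cancel_of_le hle]

/-- Division by the transformed minors, by well-founded induction on the term order. The bound by
$d$ on the remainder is kept because `degree_mem_leadSet` needs strictly smaller standard monomials.
-/
theorem monomial_mem_sup_span_standard (G : SimpleGraph (Fin n)) (g : Fin n → GL (Fin 2) K)
    (a : Fin n →₀ ℕ) (d : Fin n × Fin 2 →₀ ℕ) (hd : Finsupp.weight mdeg d = a) :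
    monomial d (1 : K) ∈ ((binomialEdgeIdeal K G).map (coordChange g)).restrictScalars K ⊔
      Submodule.span K ((fun d => monomial d (1 : K)) ''
        {d' | d' ∈ standard (leadSet m G g) a ∧ m.toSyn d' ≤ m.toSyn d}) := by
  induction hs : m.toSyn d using WellFoundedLT.induction generalizing d with
  | ind s ih =>
  subst hs
  by_cases hL : d ∈ leadSet m G g
  · obtain ⟨i, j, hij, hr, hle⟩ := hL
    obtain ⟨h1, h2, h3⟩ := monomial_mul_coordChange_minor_mem m g hij hr hle
    set p := monomial (d - m.degree (coordChange g (minor K i j))) (1 : K) *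
      coordChange g (minor K i j)
    have hp : p ≠ 0 := mul_ne_zero (by simp) (coordChange_minor_ne_zero g hij)
    have hc : coeff d p ≠ 0 := by rw [← h3]; exact m.coeff_degree_ne_zero_iff.2 hp
    rw [show monomial d (1 : K) = (coeff d p)⁻¹ • p + (monomial d 1 - (coeff d p)⁻¹ • p) by abel]
    refine add_mem (Submodule.smul_mem _ _ (Submodule.mem_sup_left h1)) (sum_monomial_mem ?_)
    intro d' hd'
    have hne : d' ≠ d := by
      rintro rfl
      rw [mem_support_iff, coeff_sub, coeff_monomial, if_pos rfl, coeff_smul, smul_eq_mul,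
        inv_mul_cancel₀ hc, sub_self] at hd'
      exact hd' rfl
    have hd'p : d' ∈ p.support := by
      rw [mem_support_iff, coeff_sub, coeff_monomial, if_neg hne.symm, coeff_smul, zero_sub,
        neg_ne_zero, smul_eq_mul] at hd'
      exact mem_support_iff.2 (right_ne_zero_of_mul hd')
    have hlt : m.toSyn d' < m.toSyn d := by
      refine lt_of_le_of_ne ?_ (m.toSyn.injective.ne hne)
      have := m.le_degree hd'p
      rwa [h3] at this
    have hmem := ih _ hlt d' ((h2 (mem_support_iff.1 hd'p)).trans hd) rfl
    refine SetLike.le_def.1 (sup_le_sup_left (Submodule.span_mono (Set.image_mono ?_)) _) hmem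
    exact fun e he => ⟨he.1, he.2.trans hlt.le⟩
  · exact Submodule.mem_sup_right (Submodule.subset_span ⟨d, ⟨mem_standard.2 ⟨hd, hL⟩, le_rfl⟩, rfl⟩)

theorem mem_sup_span_standard (G : SimpleGraph (Fin n)) (g : Fin n → GL (Fin 2) K)
    {a : Fin n →₀ ℕ} {f : MvPolynomial (Fin n × Fin 2) K} (hf : IsWeightedHomogeneous mdeg f a) :
    f ∈ ((binomialEdgeIdeal K G).map (coordChange g)).restrictScalars K ⊔
      Submodule.span K (Set.range fun d : standard (leadSet m G g) a =>
        monomial d.1 (1 : K)) := by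
  refine sum_monomial_mem fun d hd => ?_
  refine SetLike.le_def.1 (sup_le_sup_left (Submodule.span_mono ?_) _)
    (monomial_mem_sup_span_standard m G g a d (hf (mem_support_iff.1 hd)))
  rintro _ ⟨e, he, rfl⟩
  exact ⟨⟨e, he.1⟩, rfl⟩

/-- The collapsing homomorphism in the new coordinates. -/
noncomputable def collapseChange (G : SimpleGraph (Fin n)) (g : Fin n → GL (Fin 2) K)
    (T : Finset (Fin n)) : MvPolynomial (Fin n × Fin 2) K →ₗ[K]
      MvPolynomial ((restrict G T).ConnectedComponent × Fin 2) K :=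
  ((collapse K G T).comp (coordChange g⁻¹)).toLinearMap

theorem collapseChange_eq_zero_of_mem {G : SimpleGraph (Fin n)} {g : Fin n → GL (Fin 2) K}
    (T : Finset (Fin n)) {f : MvPolynomial (Fin n × Fin 2) K}
    (hf : f ∈ (binomialEdgeIdeal K G).map (coordChange g)) : collapseChange G g T f = 0 :=
  collapse_eq_zero_of_mem T (mem_map_coordChange.1 hf)

/-- The division puts the `standardCount` independent collapsed monomials into the span of the
images of the standard ones, and there are at most `standardCount` of the latter. Both assertions
follow from this comparison. -/
theorem linearIndependent_standard (G : SimpleGraph (Fin n)) (g : Fin n → GL (Fin 2) K)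
    (a : Fin n →₀ ℕ) :
    (LinearIndependent K fun d : standard (leadSet m G g) a =>
        collapseChange G g a.support (monomial d.1 1)) ∧
      (standard (leadSet m G g) a).card = standardCount G a := by
  classical
  obtain ⟨d, hd, hli⟩ := exists_linearIndependent_collapse (K := K) G a
  have hcard : Fintype.card (∀ C : (restrict G a.support).ConnectedComponent,
      Fin ((∑ i : {i // (restrict G a.support).connectedComponentMk i = C}, a i) + 1)) =
        standardCount G a := by
    rw [Fintype.card_pi, standardCount]
    simp only [Fintype.card_fin]
  have := linearIndependent_of_mem_span
    (v := fun d : standard (leadSet m G g) a => collapseChange G g a.support (monomial d.1 1))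
    hli (fun k => ?_) ?_
  · refine ⟨this.1, ?_⟩
    rw [← hcard, ← Fintype.card_coe, this.2]
  · have h := mem_sup_span_standard m G g (isWeightedHomogeneous_coordChange g
      (isWeightedHomogeneous_monomial mdeg (d k) (1 : K) (hd k)))
    obtain ⟨f, hf, w, hw, hfw⟩ := Submodule.mem_sup.1 h
    have hθ := congrArg (collapseChange G g a.support) hfw
    rw [map_add, collapseChange_eq_zero_of_mem _ hf, zero_add] at hθ
    have : collapseChange G g a.support (coordChange g (monomial (d k) 1)) =
        collapse K G a.support (monomial (d k) 1) := by
      change collapse K G a.support (coordChange g⁻¹ _) = _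
      rw [coordChange_inv_coordChange]
    rw [← this, ← hθ]
    have hw' := Submodule.mem_map_of_mem (f := collapseChange G g a.support) hw
    rwa [Submodule.map_span, ← Set.range_comp] at hw'
  · rw [Fintype.card_coe]
    refine (card_standard_leadSet_le m G g a).trans (le_of_eq ?_)
    rw [← hcard]

theorem mem_of_collapseChange_eq_zero
    (m : MonomialOrder.{0, w} (Fin n × Fin 2)) (G : SimpleGraph (Fin n)) (g : Fin n → GL (Fin 2) K)
    {a : Fin n →₀ ℕ} {f : MvPolynomial (Fin n × Fin 2) K} (hf : IsWeightedHomogeneous mdeg f a)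
    (h : collapseChange G g a.support f = 0) :
    f ∈ (binomialEdgeIdeal K G).map (coordChange g) := by
  obtain ⟨f₁, hf₁, w, hw, rfl⟩ := Submodule.mem_sup.1 (mem_sup_span_standard m G g hf)
  rw [map_add, collapseChange_eq_zero_of_mem _ hf₁, zero_add] at h
  obtain ⟨c, rfl⟩ := (Submodule.mem_span_range_iff_exists_fun K).1 hw
  simp only [map_sum, map_smul] at h
  have := Fintype.linearIndependent_iff.1 (linearIndependent_standard m G g a).1 c h
  simpa [this] using hf₁

/-- If the leading exponent $d$ of $f$ were standard, one would take the component of $f$ of the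
multidegree of $d$ and reduce its other terms to standard monomials smaller than $d$. Since the
collapse kills the ideal, the image of the monomial $d$ would then be a combination of images of
smaller standard monomials, against their independence. -/
theorem degree_mem_leadSet {G : SimpleGraph (Fin n)} {g : Fin n → GL (Fin 2) K}
    {f : MvPolynomial (Fin n × Fin 2) K} (hf : f ∈ (binomialEdgeIdeal K G).map (coordChange g))
    (hf0 : f ≠ 0) : m.degree f ∈ leadSet m G g := by
  classical
  by_contra hL
  set d := m.degree f with hd
  set a := Finsupp.weight mdeg d with ha
  have hdS : d ∈ standard (leadSet m G g) a := mem_standard.2 ⟨rfl, hL⟩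
  set p := weightedHomogeneousComponent mdeg a f with hpdef
  have hp : p ∈ (binomialEdgeIdeal K G).map (coordChange g) :=
    (isMultigraded_binomialEdgeIdeal G).map_coordChange g f hf a
  have hcp : coeff d p ≠ 0 := by
    rw [hpdef, coeff_weightedHomogeneousComponent, if_pos rfl]
    exact m.coeff_degree_ne_zero_iff.2 hf0
  have hrest : p - monomial d (coeff d p) ∈
      ((binomialEdgeIdeal K G).map (coordChange g)).restrictScalars K ⊔
      Submodule.span K ((fun d => monomial d (1 : K)) ''
        {d' | d' ∈ standard (leadSet m G g) a ∧ m.toSyn d' < m.toSyn d}) := by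
    refine sum_monomial_mem fun e he => ?_
    have hne : e ≠ d := by
      rintro rfl
      simp at he
    have hep : e ∈ p.support := by
      simpa [coeff_monomial, hne.symm] using he
    have hef : Finsupp.weight mdeg e = a ∧ e ∈ f.support := by
      rw [mem_support_iff, hpdef, coeff_weightedHomogeneousComponent] at hep
      simpa using hep
    have hlt : m.toSyn e < m.toSyn d :=
      lt_of_le_of_ne (m.le_degree hef.2) (m.toSyn.injective.ne hne)
    refine SetLike.le_def.1 (sup_le_sup_left (Submodule.span_mono (Set.image_mono ?_)) _)
      (monomial_mem_sup_span_standard m G g a e hef.1)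
    exact fun e' he' => ⟨he'.1, he'.2.trans_lt hlt⟩
  obtain ⟨f₁, hf₁, w, hw, hfw⟩ := Submodule.mem_sup.1 hrest
  have hθ := congrArg (collapseChange G g a.support) hfw
  rw [map_add, map_sub, collapseChange_eq_zero_of_mem _ hf₁, collapseChange_eq_zero_of_mem _ hp,
    zero_add, zero_sub, ← mul_one (coeff d p), ← smul_eq_mul, ← smul_monomial, map_smul] at hθ
  have hli := (linearIndependent_standard m G g a).1
  refine hli.notMem_span_image (s := {e | m.toSyn e.1 < m.toSyn d}) (x := ⟨d, hdS⟩)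
    (by simp) ?_
  have h1 : collapseChange G g a.support w ∈ Submodule.span K
      ((fun d : standard (leadSet m G g) a => collapseChange G g a.support (monomial d.1 1)) ''
        {e | m.toSyn e.1 < m.toSyn d}) := by
    have hw' := Submodule.mem_map_of_mem (f := collapseChange G g a.support) hw
    rw [Submodule.map_span] at hw'
    refine Submodule.span_mono ?_ hw'
    rintro _ ⟨_, ⟨e, he, rfl⟩, rfl⟩
    exact ⟨⟨e, he.1⟩, he.2, rfl⟩
  have h2 := Submodule.smul_mem _ (-(coeff d p)⁻¹) h1
  rw [hθ, neg_smul_neg, smul_smul, inv_mul_cancel₀ hcp, one_smul] at h2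
  exact h2

theorem initialIdeal_map_coordChange (G : SimpleGraph (Fin n)) (g : Fin n → GL (Fin 2) K) :
    initialIdeal m ((binomialEdgeIdeal K G).map (coordChange g)) =
      Ideal.span ((fun d => monomial d (1 : K)) '' leadSet m G g) := by
  apply le_antisymm
  · refine Ideal.span_le.2 ?_
    rintro _ ⟨f, hf, rfl⟩
    by_cases hf0 : f = 0
    · rw [hf0, m.leadingTerm_zero]; exact zero_mem _
    · rw [MonomialOrder.leadingTerm, ← mul_one (m.leadingCoeff f), ← C_mul_monomial]
      exact Ideal.mul_mem_left _ _ (Ideal.subset_span ⟨_, degree_mem_leadSet m hf hf0, rfl⟩)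
  · refine Ideal.span_le.2 ?_
    rintro _ ⟨d, ⟨i, j, hij, hr, hle⟩, rfl⟩
    obtain ⟨h1, -, h3⟩ := monomial_mul_coordChange_minor_mem m g hij hr hle
    set p := monomial (d - m.degree (coordChange g (minor K i j))) (1 : K) *
      coordChange g (minor K i j)
    have hp : m.leadingCoeff p ≠ 0 := m.leadingCoeff_ne_zero_iff.2
      (mul_ne_zero (by simp) (coordChange_minor_ne_zero g hij))
    have h4 : m.leadingTerm p ∈ initialIdeal m ((binomialEdgeIdeal K G).map (coordChange g)) :=
      Ideal.subset_span ⟨p, h1, rfl⟩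
    have h5 := Ideal.mul_mem_left _ (C (m.leadingCoeff p)⁻¹) h4
    rwa [MonomialOrder.leadingTerm, C_mul_monomial, inv_mul_cancel₀ hp, h3] at h5

/-! ### Hilbert functions -/

theorem weightedHomogeneousSubmodule_eq_span (a : Fin n →₀ ℕ) :
    weightedHomogeneousSubmodule K (mdeg (n := n)) a =
      Submodule.span K ((fun d => monomial d (1 : K)) '' (exponents a : Set _)) := by
  apply le_antisymm
  · intro f hf
    exact sum_monomial_mem fun d hd => Submodule.subset_span
      ⟨d, Finset.mem_coe.2 (mem_exponents.2 (hf (mem_support_iff.1 hd))), rfl⟩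
  · rw [Submodule.span_le]
    rintro _ ⟨d, hd, rfl⟩
    exact isWeightedHomogeneous_monomial mdeg d 1 (mem_exponents.1 (Finset.mem_coe.1 hd))

/-- By `h1` and `h2` the monomials of $S$ span a complement of $I_a$ in the full degree $a$ part. -/
theorem finrank_component_add_card {I : Ideal (MvPolynomial (Fin n × Fin 2) K)}
    {a : Fin n →₀ ℕ} {S : Finset (Fin n × Fin 2 →₀ ℕ)}
    (hS : ∀ d ∈ S, Finsupp.weight mdeg d = a)
    (h1 : ∀ d, Finsupp.weight mdeg d = a → monomial d (1 : K) ∈ I.restrictScalars K ⊔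
      Submodule.span K (Set.range fun d : S => monomial d.1 (1 : K)))
    (h2 : ∀ f ∈ I, f ∈ Submodule.span K (Set.range fun d : S => monomial d.1 (1 : K)) → f = 0) :
    Module.finrank K (component I a) + S.card =
      Module.finrank K (weightedHomogeneousSubmodule K (mdeg (n := n)) a) := by
  set N := Submodule.span K (Set.range fun d : S => monomial d.1 (1 : K)) with hN
  have hNle : N ≤ weightedHomogeneousSubmodule K mdeg a := by
    rw [hN, Submodule.span_le]
    rintro _ ⟨d, rfl⟩
    exact isWeightedHomogeneous_monomial mdeg d.1 1 (hS _ d.2)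
  have hfd : FiniteDimensional K (weightedHomogeneousSubmodule K (mdeg (n := n)) a) := by
    rw [weightedHomogeneousSubmodule_eq_span]
    exact FiniteDimensional.span_of_finite K ((Finset.finite_toSet _).image _)
  have hsup : component I a ⊔ N = weightedHomogeneousSubmodule K mdeg a := by
    apply le_antisymm (sup_le inf_le_right hNle)
    intro f hf
    have : f ∈ I.restrictScalars K ⊔ N :=
      sum_monomial_mem fun d hd => h1 d (hf (mem_support_iff.1 hd))
    obtain ⟨p, hp, q, hq, rfl⟩ := Submodule.mem_sup.1 this
    refine Submodule.add_mem_sup ⟨hp, ?_⟩ hq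
    have := sub_mem hf (hNle hq)
    rwa [add_sub_cancel_right] at this
  have hinf : component I a ⊓ N = ⊥ := by
    rw [eq_bot_iff]
    rintro f ⟨hf, hfN⟩
    exact h2 f hf.1 hfN
  have hNcard : Module.finrank K N = S.card := by
    rw [hN, finrank_span_eq_card, Fintype.card_coe]
    have := (basisMonomials (Fin n × Fin 2) K).linearIndependent.comp
      (Subtype.val : S → _) Subtype.val_injective
    rwa [coe_basisMonomials] at this
  have : FiniteDimensional K (component I a) :=
    Submodule.finiteDimensional_of_le (inf_le_right :
      component I a ≤ weightedHomogeneousSubmodule K mdeg a)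
  have : FiniteDimensional K N := Submodule.finiteDimensional_of_le hNle
  have h := Submodule.finrank_sup_add_finrank_inf_eq (component I a) N
  rw [hsup, hinf, finrank_bot, hNcard] at h
  omega

theorem finrank_component_map_coordChange
    (m : MonomialOrder.{0, w} (Fin n × Fin 2)) (G : SimpleGraph (Fin n)) (g : Fin n → GL (Fin 2) K)
    (a : Fin n →₀ ℕ) :
    Module.finrank K (component ((binomialEdgeIdeal K G).map (coordChange g)) a) +
        standardCount G a =
      Module.finrank K (weightedHomogeneousSubmodule K (mdeg (n := n)) a) := by
  rw [← (linearIndependent_standard m G g a).2]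
  refine finrank_component_add_card (fun d hd => (mem_standard.1 hd).1) (fun d hd =>
    mem_sup_span_standard m G g (isWeightedHomogeneous_monomial mdeg d 1 hd)) fun f hf hfN => ?_
  obtain ⟨c, rfl⟩ := (Submodule.mem_span_range_iff_exists_fun K).1 hfN
  have h := collapseChange_eq_zero_of_mem a.support hf
  simp only [map_sum, map_smul] at h
  have := Fintype.linearIndependent_iff.1 (linearIndependent_standard m G g a).1 c h
  simp [this]

theorem finrank_component_span_monomial (L : Set (Fin n × Fin 2 →₀ ℕ))
    (hL : ∀ d ∈ L, ∀ e, d ≤ e → e ∈ L) (a : Fin n →₀ ℕ) :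
    Module.finrank K (component (Ideal.span ((fun d => monomial d (1 : K)) '' L)) a) +
        (standard L a).card =
      Module.finrank K (weightedHomogeneousSubmodule K (mdeg (n := n)) a) := by
  refine finrank_component_add_card (fun d hd => (mem_standard.1 hd).1) (fun d hd => ?_)
    fun f hf hfN => ?_
  · by_cases h : d ∈ L
    · exact Submodule.mem_sup_left (Ideal.subset_span ⟨d, h, rfl⟩)
    · exact Submodule.mem_sup_right
        (Submodule.subset_span ⟨⟨d, mem_standard.2 ⟨hd, h⟩⟩, rfl⟩)
  · rw [mem_ideal_span_monomial_image] at hf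
    obtain ⟨c, rfl⟩ := (Submodule.mem_span_range_iff_exists_fun K).1 hfN
    by_contra hne
    obtain ⟨d, hd⟩ := MvPolynomial.support_nonempty.2 hne
    obtain ⟨e, he, hed⟩ := hf d hd
    have hdL := hL e he d hed
    apply mem_support_iff.1 hd
    rw [coeff_sum]
    refine Finset.sum_eq_zero fun e' _ => ?_
    rw [coeff_smul, coeff_monomial, if_neg, smul_zero]
    rintro rfl
    exact (mem_standard.1 e'.2).2 hdL

end Order

/-! ### Radical monomial ideals -/

/-- Only the part $f_2$ of $f$ with exponents outside $L$ matters. The leading exponent of $f_2^k$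
is $k$ times that of $f_2$ and occurs in its support, so $f_2^k\in I$ would put the leading exponent
of $f_2$ into $L$. The term order is merely a tool here. -/
theorem isRadical_span_monomial {σ : Type*} (m : MonomialOrder.{_, w} σ) {L : Set (σ →₀ ℕ)}
    (hup : ∀ d ∈ L, ∀ e, d ≤ e → e ∈ L) (hL : ∀ (k : ℕ) (d), k • d ∈ L → d ∈ L) :
    (Ideal.span ((fun d => monomial d (1 : K)) '' L)).IsRadical := by
  classical
  set I := Ideal.span ((fun d => monomial d (1 : K)) '' L) with hI
  intro f hf
  have hIsum : ∑ d ∈ f.support with d ∈ L, monomial d (coeff d f) ∈ I := sum_mem fun d hd => by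
    rw [← mul_one (coeff d f), ← C_mul_monomial]
    exact Ideal.mul_mem_left _ _ (Ideal.subset_span ⟨d, (Finset.mem_filter.1 hd).2, rfl⟩)
  have hsplit := Finset.sum_filter_add_sum_filter_not f.support (· ∈ L)
    fun d => monomial d (coeff d f)
  rw [← f.as_sum] at hsplit
  set f₁ := ∑ d ∈ f.support with d ∈ L, monomial d (coeff d f)
  set f₂ := ∑ d ∈ f.support with d ∉ L, monomial d (coeff d f) with hf₂
  have hrad : f₂ ∈ I.radical := by
    rw [← hsplit] at hf
    exact (Submodule.add_mem_iff_right _ (Ideal.le_radical hIsum)).1 hf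
  obtain ⟨k, hk⟩ := hrad
  suffices f₂ = 0 by rw [← hsplit, this, add_zero]; exact hIsum
  by_contra hne
  have hc : k • m.degree f₂ ∈ (f₂ ^ k).support := by
    rw [← m.degree_pow]
    exact m.degree_mem_support (pow_ne_zero k hne)
  rw [hI, mem_ideal_span_monomial_image] at hk
  obtain ⟨e, he, hle⟩ := hk _ hc
  have hdeg : m.degree f₂ ∈ L := hL k _ (hup e he _ hle)
  have hmem := m.degree_mem_support hne
  apply mem_support_iff.1 hmem
  conv_lhs => rw [hf₂]
  rw [coeff_sum]
  refine Finset.sum_eq_zero fun d hd => ?_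
  rw [coeff_monomial, if_neg]
  rintro rfl
  exact (Finset.mem_filter.1 hd).2 hdeg

theorem support_weight_mdeg_mono {d e : Fin n × Fin 2 →₀ ℕ} (h : d ≤ e) :
    (Finsupp.weight mdeg d).support ⊆ (Finsupp.weight mdeg e).support := by
  intro i hi
  rw [mem_support_weight_mdeg] at hi ⊢
  obtain ⟨s, hs⟩ := hi
  exact ⟨s, fun h0 => hs (Nat.le_zero.1 (h0 ▸ h (i, s)))⟩

theorem support_weight_mdeg_nsmul (k : ℕ) (d : Fin n × Fin 2 →₀ ℕ) :
    (Finsupp.weight mdeg (k • d)).support ⊆ (Finsupp.weight mdeg d).support := by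
  intro i hi
  rw [mem_support_weight_mdeg] at hi ⊢
  obtain ⟨s, hs⟩ := hi
  exact ⟨s, fun h0 => hs (by simp [h0])⟩

theorem leadSet_mono (m : MonomialOrder.{0, w} (Fin n × Fin 2)) (G : SimpleGraph (Fin n))
    (g : Fin n → GL (Fin 2) K) {d e : Fin n × Fin 2 →₀ ℕ} (hd : d ∈ leadSet m G g) (h : d ≤ e) :
    e ∈ leadSet m G g := by
  obtain ⟨i, j, hij, hr, hle⟩ := hd
  exact ⟨i, j, hij, hr.mono (restrict_mono_right G (support_weight_mdeg_mono h)), hle.trans h⟩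

theorem isRadical_initialIdeal (m : MonomialOrder.{0, w} (Fin n × Fin 2))
    (G : SimpleGraph (Fin n)) (g : Fin n → GL (Fin 2) K) :
    (initialIdeal m ((binomialEdgeIdeal K G).map (coordChange g))).IsRadical := by
  rw [initialIdeal_map_coordChange]
  refine isRadical_span_monomial m (fun d hd e h => leadSet_mono m G g hd h) ?_
  rintro k d ⟨i, j, hij, hr, hle⟩
  refine ⟨i, j, hij, hr.mono (restrict_mono_right G (support_weight_mdeg_nsmul k d)), ?_⟩
  obtain ⟨s, t, hdeg, -⟩ := exists_degree_coordChange_minor m g hij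
  rw [hdeg, pairExp_le_iff hij] at hle ⊢
  exact hle.imp (fun h h0 => h (by simp [h0])) (fun h h0 => h (by simp [h0]))

/-! ### The path ideal -/

/-- The exponents of the monomials in the path ideal. -/
def pathSet (G : SimpleGraph (Fin n)) : Set (Fin n × Fin 2 →₀ ℕ) :=
  {d | ∃ i j, i ≠ j ∧ (restrict G (Finsupp.weight mdeg d).support).Reachable i j ∧
    d (i, 0) ≠ 0 ∧ d (j, 0) ≠ 0}

theorem pathSet_mono {G : SimpleGraph (Fin n)} {d e : Fin n × Fin 2 →₀ ℕ} (hd : d ∈ pathSet G)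
    (h : d ≤ e) : e ∈ pathSet G := by
  obtain ⟨i, j, hij, hr, hi, hj⟩ := hd
  have hi' := h (i, 0)
  have hj' := h (j, 0)
  exact ⟨i, j, hij, hr.mono (restrict_mono_right G (support_weight_mdeg_mono h)), by omega,
    by omega⟩

theorem restrict_le (G : SimpleGraph (Fin n)) (T : Finset (Fin n)) : restrict G T ≤ G :=
  fun _ _ h => h.1

theorem mem_of_mem_support_walk {G : SimpleGraph (Fin n)} {T : Finset (Fin n)} {i j : Fin n}
    (p : (restrict G T).Walk i j) (hi : i ∈ T) {a : Fin n} (ha : a ∈ p.support) : a ∈ T := by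
  induction p with
  | nil => simp at ha; rwa [ha]
  | cons h p ih =>
    rw [SimpleGraph.Walk.support_cons, List.mem_cons] at ha
    rcases ha with rfl | ha
    · exact hi
    · exact ih h.2.2 ha

theorem reachable_restrict_of_walk {G : SimpleGraph (Fin n)} {T : Finset (Fin n)} {i j : Fin n}
    (p : G.Walk i j) (hp : ∀ a ∈ p.support, a ∈ T) : (restrict G T).Reachable i j := by
  induction p with
  | nil => rfl
  | cons h p ih =>
    rw [SimpleGraph.Walk.support_cons] at hp
    have hadj : (restrict G T).Adj _ _ :=
      ⟨h, hp _ (by simp), hp _ (List.mem_cons_of_mem _ p.start_mem_support)⟩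
    exact hadj.reachable.trans (ih fun a ha => hp a (List.mem_cons_of_mem _ ha))

/-- The exponent of `xᵢ xⱼ ∏ yₐ`, the product being over `S`. -/
noncomputable def pathExp (S : Finset (Fin n)) (i j : Fin n) : Fin n × Fin 2 →₀ ℕ :=
  ∑ a ∈ S, Finsupp.single (a, 1) 1 + Finsupp.single (i, 0) 1 + Finsupp.single (j, 0) 1

theorem prod_X_mul_X_mul_X (S : Finset (Fin n)) (i j : Fin n) :
    (∏ a ∈ S, X (a, 1)) * X (i, 0) * X (j, 0) = monomial (pathExp S i j) (1 : K) := by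
  have : ∏ a ∈ S, (X (a, 1) : MvPolynomial (Fin n × Fin 2) K) =
      monomial (∑ a ∈ S, Finsupp.single (a, 1) 1) 1 := by
    rw [monomial_sum_one]; rfl
  rw [this, X, X, monomial_mul, monomial_mul, pathExp, mul_one, mul_one]

theorem pathExp_apply_one (S : Finset (Fin n)) (i j a : Fin n) [Decidable (a ∈ S)] :
    pathExp S i j (a, 1) = if a ∈ S then 1 else 0 := by
  simp only [pathExp, Finsupp.add_apply, Finsupp.finsetSum_apply, Finsupp.single_apply,
    Prod.mk.injEq, and_true, zero_ne_one, and_false, if_false, add_zero]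
  rw [Finset.sum_ite_eq' S a]
  congr

theorem pathExp_apply_zero (S : Finset (Fin n)) (i j a : Fin n) :
    pathExp S i j (a, 0) = (if i = a then 1 else 0) + if j = a then 1 else 0 := by
  simp [pathExp, Finsupp.single_apply]

/-- If some interior vertex $a$ of the path has $x_a$ dividing the monomial, the path is cut at $a$
and the induction on length applies. Otherwise each interior vertex, being in the support,
contributes $y_a$, and the generator attached to the path divides the monomial. -/
theorem monomial_mem_pathIdeal {G : SimpleGraph (Fin n)} {d : Fin n × Fin 2 →₀ ℕ} {l : ℕ}
    {i j : Fin n} (p : (restrict G (Finsupp.weight mdeg d).support).Walk i j) (hl : p.length = l)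
    (hij : i ≠ j) (hi : d (i, 0) ≠ 0) (hj : d (j, 0) ≠ 0) :
    monomial d (1 : K) ∈ pathIdeal K G := by
  induction l using Nat.strong_induction_on generalizing j with
  | _ l ih =>
  subst hl
  by_cases h : ∃ a ∈ p.bypass.support, a ≠ i ∧ a ≠ j ∧ d (a, 0) ≠ 0
  · obtain ⟨a, ha, hai, haj, hda⟩ := h
    exact ih _ ((SimpleGraph.Walk.length_takeUntil_lt_length ha haj).trans_le
      p.length_bypass_le_length) (p.bypass.takeUntil a ha) rfl hai.symm hda
  · push Not at h
    let q : G.Walk i j := p.bypass.mapLe (restrict_le G _)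
    have hq : q.IsPath := p.bypass_isPath.mapLe _
    have hsupp : q.support = p.bypass.support := by simp [q]
    have hgen : monomial (pathExp (q.support.toFinset \ {i, j}) i j) (1 : K) ∈ pathIdeal K G :=
      Ideal.subset_span ⟨i, j, q, hij, hq, (prod_X_mul_X_mul_X _ _ _).symm⟩
    have hle : pathExp (q.support.toFinset \ {i, j}) i j ≤ d := by
      rintro ⟨a, e⟩
      revert e
      rw [Fin.forall_fin_two]
      constructor
      · rw [pathExp_apply_zero]
        split_ifs with h1 h2 h2
        · exact absurd (h1.trans h2.symm) hij
        · subst h1; omega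
        · subst h2; omega
        · omega
      · rw [pathExp_apply_one]
        split_ifs with ha
        · simp only [Finset.mem_sdiff, List.mem_toFinset, Finset.mem_insert,
            Finset.mem_singleton, not_or, hsupp] at ha
          have h0 := h a ha.1 ha.2.1 ha.2.2
          have hT := mem_of_mem_support_walk p.bypass (mem_support_weight_mdeg.2 ⟨0, hi⟩) ha.1
          rw [mem_support_weight_mdeg, Fin.exists_fin_two] at hT
          have := hT.resolve_left (not_not.2 h0)
          omega
        · omega
    have := Ideal.mul_mem_left (pathIdeal K G)
      (monomial (d - pathExp (q.support.toFinset \ {i, j}) i j) 1) hgen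
    rwa [monomial_mul, tsub_add_cancel_of_le hle, one_mul] at this

variable (K) in
theorem pathIdeal_eq_span (G : SimpleGraph (Fin n)) :
    pathIdeal K G = Ideal.span ((fun d => monomial d (1 : K)) '' pathSet G) := by
  apply le_antisymm
  · refine Ideal.span_le.2 ?_
    rintro _ ⟨i, j, q, hij, hq, rfl⟩
    rw [prod_X_mul_X_mul_X]
    refine Ideal.subset_span ⟨_, ⟨i, j, hij, reachable_restrict_of_walk q fun a ha => ?_, ?_, ?_⟩,
      rfl⟩
    · rw [mem_support_weight_mdeg, Fin.exists_fin_two, pathExp_apply_one, pathExp_apply_zero]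
      by_cases hai : i = a
      · simp [hai]
      by_cases haj : j = a
      · simp [haj]
      right
      simp [ha, Ne.symm hai, Ne.symm haj]
    · rw [pathExp_apply_zero]; simp
    · rw [pathExp_apply_zero]; simp
  · refine Ideal.span_le.2 ?_
    rintro _ ⟨d, ⟨i, j, hij, ⟨p⟩, hi, hj⟩, rfl⟩
    exact monomial_mem_pathIdeal p rfl hij hi hj

/-! ### The generic initial ideal -/

theorem leadSet_eq_pathSet {m : MonomialOrder.{0, w} (Fin n × Fin 2)}
    (hm : ∀ i : Fin n, m.toSyn (Finsupp.single (i, 1) 1) < m.toSyn (Finsupp.single (i, 0) 1))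
    (G : SimpleGraph (Fin n)) {g : Fin n → GL (Fin 2) K}
    (hg : ∀ i j, i ≠ j → minorCoeff g i j 0 0 ≠ 0) : leadSet m G g = pathSet G := by
  ext d
  refine exists_congr fun i => exists_congr fun j => and_congr_right fun hij =>
    and_congr_right fun _ => ?_
  have := degree_coordChange_minor_of_ne_zero m (g := g) hij (by
    rw [bigIdx_eq_zero m (hm i), bigIdx_eq_zero m (hm j)]; exact hg i j hij)
  rw [this, bigIdx_eq_zero m (hm i), bigIdx_eq_zero m (hm j), pairExp_le_iff hij]

variable (K n) in
theorem exists_generic [Infinite K] :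
    ∃ g : Fin n → GL (Fin 2) K, ∀ i j, i ≠ j → minorCoeff g i j 0 0 ≠ 0 := by
  -- Shears $y_i\mapsto t_ix_i+y_i$ with distinct $t_i$: the coefficient of $x_ix_j$ is $t_j-t_i$.
  refine ⟨fun i => Matrix.GeneralLinearGroup.mkOfDetNeZero
    !![1, Infinite.natEmbedding K i; 0, 1] (by simp), fun i j hij => ?_⟩
  have : Infinite.natEmbedding K j - Infinite.natEmbedding K i ≠ 0 :=
    sub_ne_zero.2 ((Infinite.natEmbedding K).injective.ne (Fin.val_injective.ne hij.symm))
  simpa [minorCoeff, Matrix.GeneralLinearGroup.mkOfDetNeZero] using this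

theorem isMultigradedGin_pathIdeal [Infinite K] {m : MonomialOrder.{0, w} (Fin n × Fin 2)}
    (hm : ∀ i : Fin n, m.toSyn (Finsupp.single (i, 1) 1) < m.toSyn (Finsupp.single (i, 0) 1))
    (G : SimpleGraph (Fin n)) :
    IsMultigradedGin m (binomialEdgeIdeal K G) (pathIdeal K G) := by
  let p : MvPolynomial (Fin n × Fin 2 × Fin 2) K :=
    ∏ q : Fin n × Fin n with q.1 ≠ q.2,
      (X (q.1, 0, 0) * X (q.2, 0, 1) - X (q.2, 0, 0) * X (q.1, 0, 1))
  have hp : ∀ g : Fin n → GL (Fin 2) K,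
      eval (fun e => (g e.1 : Matrix (Fin 2) (Fin 2) K) e.2.1 e.2.2) p ≠ 0 ↔
        ∀ i j, i ≠ j → minorCoeff g i j 0 0 ≠ 0 := by
    intro g
    simp [p, Finset.prod_eq_zero_iff, minorCoeff]
  refine ⟨p, ?_, fun g hg => ?_⟩
  · obtain ⟨g, hg⟩ := exists_generic K n
    exact ⟨g, (hp g).2 hg⟩
  · rw [initialIdeal_map_coordChange, pathIdeal_eq_span,
      leadSet_eq_pathSet hm G ((hp g).1 hg)]

/-! ### The Hilbert series and the Cartwright–Sturmfels property -/

variable (n) in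
theorem exists_monomialOrder : ∃ m : MonomialOrder.{0, 0} (Fin n × Fin 2),
    ∀ i : Fin n, m.toSyn (Finsupp.single (i, 1) 1) < m.toSyn (Finsupp.single (i, 0) 1) := by
  let ord : LinearOrder (Fin n × Fin 2) :=
    LinearOrder.lift' (toLex : Fin n × Fin 2 → Fin n ×ₗ Fin 2) toLex.injective
  have hwf : @WellFoundedGT (Fin n × Fin 2) ord.toLT :=
    @Finite.to_wellFoundedGT (Fin n × Fin 2) _ ord.toPreorder
  refine ⟨@MonomialOrder.lex _ ord hwf, fun i => ?_⟩
  refine (@Finsupp.Lex.single_lt_iff _ ord (i, 0) (i, 1)).2 ?_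
  exact Prod.Lex.toLex_lt_toLex.2 (Or.inr ⟨rfl, Fin.zero_lt_one⟩)

theorem card_standard_pathSet (G : SimpleGraph (Fin n)) (a : Fin n →₀ ℕ) :
    (standard (pathSet G) a).card = standardCount G a := by
  obtain ⟨m, hm⟩ := exists_monomialOrder n
  -- The count is purely combinatorial, so generic coordinates may be taken over $\mathbb{Q}$ even
  -- when $K$ is finite.
  obtain ⟨g, hg⟩ := exists_generic ℚ n
  rw [← leadSet_eq_pathSet hm G hg]
  exact (linearIndependent_standard m G g a).2

theorem map_coordChange_one (I : Ideal (MvPolynomial (Fin n × Fin 2) K)) :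
    I.map (coordChange 1) = I := by
  ext f
  rw [mem_map_coordChange, inv_one, coordChange_one]

theorem hilbertSeries_binomialEdgeIdeal (G : SimpleGraph (Fin n)) :
    hilbertSeries (binomialEdgeIdeal K G) = hilbertSeries (pathIdeal K G) := by
  obtain ⟨m, -⟩ := exists_monomialOrder n
  funext a
  have h1 := finrank_component_map_coordChange m G (1 : Fin n → GL (Fin 2) K) a
  have h2 := finrank_component_span_monomial (K := K) (pathSet G)
    (fun d hd e h => pathSet_mono hd h) a
  rw [map_coordChange_one] at h1
  rw [card_standard_pathSet, ← pathIdeal_eq_span] at h2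
  simp only [hilbertSeries, Nat.cast_inj]
  omega

theorem isRadical_pathIdeal (G : SimpleGraph (Fin n)) : (pathIdeal K G).IsRadical := by
  obtain ⟨m, -⟩ := exists_monomialOrder n
  rw [pathIdeal_eq_span]
  refine isRadical_span_monomial m (fun d hd e h => pathSet_mono hd h) ?_
  rintro k d ⟨i, j, hij, hr, hi, hj⟩
  exact ⟨i, j, hij, hr.mono (restrict_mono_right G (support_weight_mdeg_nsmul k d)),
    fun h0 => hi (by simp [h0]), fun h0 => hj (by simp [h0])⟩

/-- The factors $x_i$ and $x_j$ are only rescaled, and the cofactor keeps its multidegree. Hence the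
support, and with it the connection between $i$ and $j$, is unchanged. -/
theorem map_coordChange_pathIdeal_le (G : SimpleGraph (Fin n)) {g : Fin n → GL (Fin 2) K}
    (hg : ∀ i, (g i : Matrix (Fin 2) (Fin 2) K) 1 0 = 0) :
    (pathIdeal K G).map (coordChange g) ≤ pathIdeal K G := by
  rw [Ideal.map_le_iff_le_comap]
  conv_lhs => rw [pathIdeal_eq_span]
  refine Ideal.span_le.2 ?_
  rintro _ ⟨d, ⟨i, j, hij, hr, hi, hj⟩, rfl⟩
  have hX : ∀ i, coordChange g (X (i, 0)) =
      C ((g i : Matrix (Fin 2) (Fin 2) K) 0 0) * X (i, 0) := fun i => by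
    rw [coordChange_X, Fin.sum_univ_two]
    simp [hg i]
  have hle : pairExp i j 0 0 ≤ d := (pairExp_le_iff hij).2 ⟨hi, hj⟩
  have hmon : monomial d (1 : K) = X (i, 0) * X (j, 0) * monomial (d - pairExp i j 0 0) 1 := by
    rw [X, X, monomial_mul, monomial_mul, mul_one, mul_one, ← pairExp,
      add_tsub_cancel_of_le hle]
  have hhom := isWeightedHomogeneous_coordChange_monomial g (d - pairExp i j 0 0) 1
  simp only [SetLike.mem_coe, Ideal.mem_comap]
  rw [hmon, map_mul, map_mul, hX, hX]
  set q := coordChange g (monomial (d - pairExp i j 0 0) 1)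
  have hq : X (i, 0) * X (j, 0) * q ∈ pathIdeal K G := by
    rw [q.as_sum, Finset.mul_sum]
    refine sum_mem fun e he => ?_
    have hwe := hhom (mem_support_iff.1 he)
    rw [X, X, monomial_mul, monomial_mul, mul_one, one_mul, ← pairExp,
      ← mul_one (coeff e q), ← C_mul_monomial, pathIdeal_eq_span]
    refine Ideal.mul_mem_left _ _ (Ideal.subset_span ⟨_, ⟨i, j, hij, ?_, ?_, ?_⟩, rfl⟩)
    · rwa [map_add, hwe, ← map_add, add_tsub_cancel_of_le hle]
    · simp [pairExp]
    · simp [pairExp]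
  rw [show C ((g i).1 0 0) * X (i, 0) * (C ((g j).1 0 0) * X (j, 0)) * q =
    C ((g i).1 0 0) * C ((g j).1 0 0) * (X (i, 0) * X (j, 0) * q) by ring]
  exact Ideal.mul_mem_left _ _ hq

theorem isBorelFixed_pathIdeal (G : SimpleGraph (Fin n)) : IsBorelFixed (pathIdeal K G) := by
  refine ⟨⟨pathSet G, pathIdeal_eq_span K G⟩, fun g hg =>
    le_antisymm (map_coordChange_pathIdeal_le G hg) fun f hf => ?_⟩
  rw [mem_map_coordChange]
  refine map_coordChange_pathIdeal_le G (fun i => ?_) (Ideal.mem_map_of_mem (coordChange g⁻¹) hf)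
  rw [Pi.inv_apply, Matrix.coe_units_inv, Matrix.inv_def, Matrix.adjugate_fin_two]
  simp [hg i]

theorem isCartwrightSturmfels_binomialEdgeIdeal (G : SimpleGraph (Fin n)) :
    IsCartwrightSturmfels (binomialEdgeIdeal K G) :=
  ⟨isMultigraded_binomialEdgeIdeal G, pathIdeal K G, isRadical_pathIdeal G,
    isBorelFixed_pathIdeal G, hilbertSeries_binomialEdgeIdeal G⟩

/-! ### Multiplication by the variables of one vertex -/

theorem mem_binomialEdgeIdeal_iff_collapse {G : SimpleGraph (Fin n)} {a : Fin n →₀ ℕ}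
    {f : MvPolynomial (Fin n × Fin 2) K} (hf : IsWeightedHomogeneous mdeg f a) :
    f ∈ binomialEdgeIdeal K G ↔ collapse K G a.support f = 0 := by
  refine ⟨collapse_eq_zero_of_mem _, fun h => ?_⟩
  obtain ⟨m, -⟩ := exists_monomialOrder n
  have := mem_of_collapseChange_eq_zero m G (1 : Fin n → GL (Fin 2) K) hf (by
    change collapse K G a.support (coordChange 1⁻¹ f) = 0
    rw [inv_one, coordChange_one, h])
  rwa [map_coordChange_one] at this

theorem collapse_X_ne_zero (G : SimpleGraph (Fin n)) {T : Finset (Fin n)} {v : Fin n × Fin 2}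
    (hv : v.1 ∈ T) : collapse K G T (X v) ≠ 0 := by
  rw [collapse, aeval_X, if_pos hv]
  exact X_ne_zero _

/-- The collapsed ring is a domain, and the variable $v$ survives because its vertex belongs to the
enlarged support. -/
theorem collapse_eq_zero_of_X_mul_mem {G : SimpleGraph (Fin n)} {b : Fin n →₀ ℕ}
    {h : MvPolynomial (Fin n × Fin 2) K} {v : Fin n × Fin 2}
    (hv : X v * h ∈ binomialEdgeIdeal K G) :
    collapse K G (b + Finsupp.single v.1 1).support h = 0 := by
  have := collapse_eq_zero_of_mem (b + Finsupp.single v.1 1).support hv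
  rw [map_mul] at this
  exact (mul_eq_zero.1 this).resolve_left (collapse_X_ne_zero G (by simp))

theorem mem_of_X_mul_mem {G : SimpleGraph (Fin n)} {b : Fin n →₀ ℕ}
    {h : MvPolynomial (Fin n × Fin 2) K} (hh : IsWeightedHomogeneous mdeg h b)
    {v : Fin n × Fin 2} (hb : b v.1 ≠ 0) (hv : X v * h ∈ binomialEdgeIdeal K G) :
    h ∈ binomialEdgeIdeal K G := by
  rw [mem_binomialEdgeIdeal_iff_collapse hh]
  have h0 := collapse_eq_zero_of_X_mul_mem (b := b) hv
  have hs : (b + Finsupp.single v.1 1).support = b.support := by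
    ext i
    simp only [Finsupp.mem_support_iff, Finsupp.add_apply, Finsupp.single_apply]
    split_ifs with hi
    · subst hi; simp [hb]
    · simp
  rwa [hs] at h0

/-- The graph `G` with the neighborhood of `k` completed. -/
def completeAt (G : SimpleGraph (Fin n)) (k : Fin n) : SimpleGraph (Fin n) where
  Adj i j := G.Adj i j ∨ (i ≠ j ∧ G.Adj k i ∧ G.Adj k j)
  symm := ⟨fun _ _ h => h.imp (fun h => h.symm) fun h => ⟨h.1.symm, h.2.2, h.2.1⟩⟩
  loopless := ⟨fun _ h => h.elim (fun h => h.ne rfl) fun h => h.1 rfl⟩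

theorem binomialEdgeIdeal_le_completeAt (G : SimpleGraph (Fin n)) (k : Fin n) :
    binomialEdgeIdeal K G ≤ binomialEdgeIdeal K (completeAt G k) := by
  refine Ideal.span_le.2 ?_
  rintro _ ⟨i, j, h, rfl⟩
  exact minor_mem (Or.inl h)

/-- For neighbors $i,j$ of $k$, the identity $x_k[ij]=x_i[kj]-x_j[ki]$ and its analogue for $y_k$
put these products into $J_G$. -/
theorem X_mul_mem_of_mem_completeAt {G : SimpleGraph (Fin n)} {v : Fin n × Fin 2}
    {f : MvPolynomial (Fin n × Fin 2) K} (hf : f ∈ binomialEdgeIdeal K (completeAt G v.1)) :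
    X v * f ∈ binomialEdgeIdeal K G := by
  refine binomialEdgeIdeal_induction (p := fun f => X v * f ∈ binomialEdgeIdeal K G)
    ?_ ?_ ?_ hf
  · rw [mul_zero]; exact zero_mem _
  · intro f g hf hg
    rw [mul_add]; exact add_mem hf hg
  · intro i j hij d c
    rw [mul_left_comm]
    refine Ideal.mul_mem_left _ _ ?_
    rcases hij with hij | ⟨-, hi, hj⟩
    · exact Ideal.mul_mem_left _ _ (minor_mem hij)
    · obtain ⟨k, e⟩ := v
      have h1 := Ideal.mul_mem_left _ (X (i, e)) (minor_mem (K := K) hj)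
      have h2 := Ideal.mul_mem_left _ (X (j, e)) (minor_mem (K := K) hi)
      convert sub_mem h1 h2 using 1
      simp only [minor]
      fin_cases e <;> simp <;> ring

/-- A passage of the walk through $k$ is short-circuited by the edge between the two neighbors of
$k$. The second clause makes the induction work when the remaining walk starts at $k$: it may be
entered from any neighbor $l$. -/
theorem reachable_completeAt {G : SimpleGraph (Fin n)} {k : Fin n} {T : Finset (Fin n)}
    {i j : Fin n} (p : (restrict G (insert k T)).Walk i j) (hj : j ∈ T) (hjk : j ≠ k) :
    (i ≠ k → (restrict (completeAt G k) T).Reachable i j) ∧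
      (i = k → ∀ l, G.Adj k l → l ∈ T → (restrict (completeAt G k) T).Reachable l j) := by
  induction p with
  | nil => exact ⟨fun _ => SimpleGraph.Reachable.refl _, fun h => absurd h hjk⟩
  | @cons i i' j hadj p ih =>
    obtain ⟨ih1, ih2⟩ := ih hj hjk
    obtain ⟨hG, hi, hi'⟩ := hadj
    rw [Finset.mem_insert] at hi hi'
    constructor
    · intro hik
      have hiT := hi.resolve_left hik
      by_cases hk : i' = k
      · exact ih2 hk i (hk ▸ hG.symm) hiT
      · have : (restrict (completeAt G k) T).Adj i i' := ⟨Or.inl hG, hiT, hi'.resolve_left hk⟩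
        exact this.reachable.trans (ih1 hk)
    · rintro rfl l hl hlT
      have hk : i' ≠ i := hG.ne'
      by_cases hli : l = i'
      · subst hli; exact ih1 hk
      · have : (restrict (completeAt G i) T).Adj l i' :=
          ⟨Or.inr ⟨hli, hl, hG⟩, hlT, hi'.resolve_left hk⟩
        exact this.reachable.trans (ih1 hk)

/-- Cancelling the variable shows that $h$ dies under the collapse for $T\cup\{k\}$, where $T$ is
the support of $b$. Vertices of $T$ joined in $G|_{T\cup\{k\}}$ are joined in the completed graph on
$T$, so the collapse for the latter factors through the former on polynomials of degree $b$. -/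
theorem mem_completeAt_of_X_mul_mem {G : SimpleGraph (Fin n)} {b : Fin n →₀ ℕ}
    {h : MvPolynomial (Fin n × Fin 2) K} (hh : IsWeightedHomogeneous mdeg h b)
    {v : Fin n × Fin 2} (hb : b v.1 = 0) (hv : X v * h ∈ binomialEdgeIdeal K G) :
    h ∈ binomialEdgeIdeal K (completeAt G v.1) := by
  classical
  rw [mem_binomialEdgeIdeal_iff_collapse hh]
  have h0 := collapse_eq_zero_of_X_mul_mem (b := b) hv
  set k := v.1
  have hs : (b + Finsupp.single k 1).support = insert k b.support := by
    ext i
    simp only [Finsupp.mem_support_iff, Finsupp.add_apply, Finsupp.single_apply,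
      Finset.mem_insert]
    split_ifs with hi
    · subst hi; simp
    · simp [Ne.symm hi]
  rw [hs] at h0
  -- A component is sent to that of a chosen vertex in $T$; the value on a component not meeting $T$
  -- is irrelevant.
  let φ : (restrict G (insert k b.support)).ConnectedComponent →
      (restrict (completeAt G k) b.support).ConnectedComponent := fun C =>
    if hC : ∃ i ∈ b.support, (restrict G (insert k b.support)).connectedComponentMk i = C
    then (restrict (completeAt G k) b.support).connectedComponentMk hC.choose
    else (restrict (completeAt G k) b.support).connectedComponentMk k
  have hφ : ∀ i ∈ b.support, φ ((restrict G (insert k b.support)).connectedComponentMk i) =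
      (restrict (completeAt G k) b.support).connectedComponentMk i := by
    intro i hi
    have hC : ∃ j ∈ b.support, (restrict G (insert k b.support)).connectedComponentMk j =
      (restrict G (insert k b.support)).connectedComponentMk i := ⟨i, hi, rfl⟩
    simp only [φ, dif_pos hC]
    refine SimpleGraph.ConnectedComponent.eq.2 ?_
    obtain ⟨p⟩ := SimpleGraph.ConnectedComponent.eq.1 hC.choose_spec.2
    have hne : ∀ j ∈ b.support, j ≠ k := by
      rintro j hj rfl; exact Finsupp.mem_support_iff.1 hj hb
    exact (reachable_completeAt p hi (hne i hi)).1 (hne _ hC.choose_spec.1)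
  have hcomp : rename (fun v => (φ v.1, v.2)) (collapse K G (insert k b.support) h) =
      collapse K (completeAt G k) b.support h := by
    rw [h.as_sum, map_sum, map_sum, map_sum]
    refine Finset.sum_congr rfl fun d hd => ?_
    have hwd := hh (mem_support_iff.1 hd)
    rw [collapse_monomial G (by rw [hwd]; exact Finset.subset_insert _ _),
      collapse_monomial (completeAt G k) (by rw [hwd]), rename_monomial,
      ← Finsupp.mapDomain_comp]
    refine congrArg (fun e => monomial e (coeff d h)) (Finsupp.mapDomain_congr fun v hv => ?_)
    have : v.1 ∈ b.support := by
      rw [← hwd, mem_support_weight_mdeg]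
      exact ⟨v.2, Finsupp.mem_support_iff.1 hv⟩
    simp [hφ v.1 this]
  rw [← hcomp, h0, map_zero]

/-- Each generator has degree at most one in $k$. In a degree that is at least two in $k$ its
monomial cofactor therefore contains $x_k$ or $y_k$, which can be split off. -/
theorem exists_X_mul_add_X_mul {G : SimpleGraph (Fin n)} {k : Fin n} {b : Fin n →₀ ℕ}
    (hb : b k ≠ 0) {f : MvPolynomial (Fin n × Fin 2) K} (hf : f ∈ binomialEdgeIdeal K G) :
    ∃ p ∈ binomialEdgeIdeal K G, ∃ q ∈ binomialEdgeIdeal K G,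
      IsWeightedHomogeneous mdeg p b ∧ IsWeightedHomogeneous mdeg q b ∧
      weightedHomogeneousComponent mdeg (b + Finsupp.single k 1) f =
        X (k, 0) * p + X (k, 1) * q := by
  classical
  refine binomialEdgeIdeal_induction (p := fun f => ∃ p ∈ binomialEdgeIdeal K G,
      ∃ q ∈ binomialEdgeIdeal K G,
      IsWeightedHomogeneous mdeg p b ∧ IsWeightedHomogeneous mdeg q b ∧
      weightedHomogeneousComponent mdeg (b + Finsupp.single k 1) f =
        X (k, 0) * p + X (k, 1) * q) ?_ ?_ ?_ hf
  · exact ⟨0, zero_mem _, 0, zero_mem _, isWeightedHomogeneous_zero _ _ _,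
      isWeightedHomogeneous_zero _ _ _, by simp⟩
  · rintro f f' ⟨p, hp, q, hq, hpw, hqw, h⟩ ⟨p', hp', q', hq', hpw', hqw', h'⟩
    exact ⟨p + p', add_mem hp hp', q + q', add_mem hq hq', hpw.add hpw', hqw.add hqw', by
      rw [map_add, h, h']; ring⟩
  · intro i j hij d c
    rw [weightedHomogeneousComponent_of_isWeightedHomogeneous
      ((isWeightedHomogeneous_monomial mdeg d c rfl).mul (isWeightedHomogeneous_minor i j))]
    split_ifs with hw
    · have hk : k ∈ (Finsupp.weight mdeg d).support := by
        have := DFunLike.congr_fun hw k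
        simp only [Finsupp.add_apply, Finsupp.single_apply, if_true] at this
        rw [Finsupp.mem_support_iff]
        have hne := hij.ne
        split_ifs at this with h1 h2 h2
        · exact absurd (h1.trans h2.symm) hne
        all_goals omega
      obtain ⟨e, he⟩ := mem_support_weight_mdeg.1 hk
      set d' := d - Finsupp.single (k, e) 1 with hd'
      have hmem : monomial d' c * minor K i j ∈ binomialEdgeIdeal K G :=
        Ideal.mul_mem_left _ _ (minor_mem hij)
      have hhom : IsWeightedHomogeneous mdeg (monomial d' c * minor K i j) b := by
        have hb' : Finsupp.weight mdeg d' + (Finsupp.single i 1 + Finsupp.single j 1) = b := by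
          have hd'e : d = d' + Finsupp.single (k, e) 1 := by
            rw [hd', tsub_add_cancel_of_le]
            simpa [Finsupp.single_le_iff] using Nat.one_le_iff_ne_zero.2 he
          rw [hd'e, map_add, weight_mdeg_single, add_right_comm] at hw
          exact add_right_cancel hw
        rw [← hb']
        exact (isWeightedHomogeneous_monomial mdeg d' c rfl).mul (isWeightedHomogeneous_minor i j)
      rw [monomial_eq_X_mul he, ← hd', mul_assoc]
      have hz : IsWeightedHomogeneous mdeg (0 : MvPolynomial (Fin n × Fin 2) K) b :=
        isWeightedHomogeneous_zero _ _ _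
      fin_cases e
      · exact ⟨_, hmem, 0, zero_mem _, hhom, hz, by simp⟩
      · exact ⟨0, zero_mem _, _, hmem, hz, hhom, by simp⟩
    · exact ⟨0, zero_mem _, 0, zero_mem _, isWeightedHomogeneous_zero _ _ _,
        isWeightedHomogeneous_zero _ _ _, by simp⟩

/-! ### The Koszul complex -/

variable (K) in
/-- The sign of the contraction of `e_{T ∪ v}` by `v`. -/
noncomputable def koszulSign (v : Fin n × Fin 2) (T : Finset (Fin n × Fin 2)) :
    MvPolynomial (Fin n × Fin 2) K :=
  (-1) ^ (T.filter fun t => toLex t < toLex v).card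

theorem koszulSign_mul_self (v : Fin n × Fin 2) (T : Finset (Fin n × Fin 2)) :
    koszulSign K v T * koszulSign K v T = 1 := by
  rw [koszulSign, ← mul_pow]; simp

theorem koszulSign_insert {v t : Fin n × Fin 2} {T : Finset (Fin n × Fin 2)} (ht : t ∉ T) :
    koszulSign K v (insert t T) =
      (if toLex t < toLex v then -1 else 1) * koszulSign K v T := by
  rw [koszulSign, koszulSign, Finset.filter_insert]
  split_ifs with h
  · rw [Finset.card_insert_of_notMem (by simp [ht]), pow_succ']
  · rw [one_mul]

theorem koszulSign_insert_self (v : Fin n × Fin 2) (T : Finset (Fin n × Fin 2)) :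
    koszulSign K v (insert v T) = koszulSign K v T := by
  by_cases hv : v ∈ T
  · rw [Finset.insert_eq_of_mem hv]
  · rw [koszulSign_insert hv, if_neg (lt_irrefl _), one_mul]

theorem koszulD_apply (c : Finset (Fin n × Fin 2) → MvPolynomial (Fin n × Fin 2) K)
    (T : Finset (Fin n × Fin 2)) :
    koszulD c T = ∑ v ∈ Tᶜ, koszulSign K v T * X v * c (insert v T) := rfl

/-- Left multiplication by `e_v`. -/
noncomputable def wedge (v : Fin n × Fin 2)
    (c : Finset (Fin n × Fin 2) → MvPolynomial (Fin n × Fin 2) K) :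
    Finset (Fin n × Fin 2) → MvPolynomial (Fin n × Fin 2) K :=
  fun T => if v ∈ T then koszulSign K v T * c (T.erase v) else 0

theorem wedge_apply_of_notMem {v : Fin n × Fin 2} {T : Finset (Fin n × Fin 2)} (h : v ∉ T)
    (c : Finset (Fin n × Fin 2) → MvPolynomial (Fin n × Fin 2) K) : wedge v c T = 0 := if_neg h

theorem wedge_apply_insert {v : Fin n × Fin 2} {T : Finset (Fin n × Fin 2)} (h : v ∉ T)
    (c : Finset (Fin n × Fin 2) → MvPolynomial (Fin n × Fin 2) K) :
    wedge v c (insert v T) = koszulSign K v T * c T := by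
  rw [wedge, if_pos (Finset.mem_insert_self v T), koszulSign_insert_self,
    Finset.erase_insert h]

theorem wedge_zero (v : Fin n × Fin 2) :
    wedge v (0 : Finset (Fin n × Fin 2) → MvPolynomial (Fin n × Fin 2) K) = 0 := by
  funext T; simp [wedge]

theorem wedge_sub (v : Fin n × Fin 2)
    (c d : Finset (Fin n × Fin 2) → MvPolynomial (Fin n × Fin 2) K) :
    wedge v (c - d) = wedge v c - wedge v d := by
  funext T
  simp only [wedge, Pi.sub_apply]
  split_ifs <;> ring

theorem wedge_add (v : Fin n × Fin 2)
    (c d : Finset (Fin n × Fin 2) → MvPolynomial (Fin n × Fin 2) K) :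
    wedge v (c + d) = wedge v c + wedge v d := by
  funext T
  simp only [wedge, Pi.add_apply]
  split_ifs <;> ring

theorem wedge_smul (v : Fin n × Fin 2) (p : MvPolynomial (Fin n × Fin 2) K)
    (c : Finset (Fin n × Fin 2) → MvPolynomial (Fin n × Fin 2) K) :
    wedge v (p • c) = p • wedge v c := by
  funext T
  simp only [wedge, Pi.smul_apply, smul_eq_mul]
  split_ifs <;> ring

theorem koszulD_smul (p : MvPolynomial (Fin n × Fin 2) K)
    (c : Finset (Fin n × Fin 2) → MvPolynomial (Fin n × Fin 2) K) :
    koszulD (p • c) = p • koszulD c := by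
  funext T
  simp only [koszulD_apply, Pi.smul_apply, smul_eq_mul, Finset.mul_sum]
  exact Finset.sum_congr rfl fun v _ => by ring

/-- The Leibniz rule for $e_v\wedge c$; the mixed signs cancel according to which of $t$ and $v$
comes first. -/
theorem koszulD_wedge (v : Fin n × Fin 2)
    (c : Finset (Fin n × Fin 2) → MvPolynomial (Fin n × Fin 2) K) :
    koszulD (wedge v c) = (X v : MvPolynomial (Fin n × Fin 2) K) • c - wedge v (koszulD c) := by
  funext T
  rw [koszulD_apply, Pi.sub_apply, Pi.smul_apply, smul_eq_mul]
  by_cases hv : v ∈ T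
  · obtain ⟨U, hU, rfl⟩ : ∃ U, v ∉ U ∧ insert v U = T :=
      ⟨T.erase v, Finset.notMem_erase v T, Finset.insert_erase hv⟩
    have hcompl : Uᶜ = insert v (insert v U)ᶜ := by
      ext t
      by_cases ht : t = v
      · subst ht; simp [hU]
      · simp [ht]
    rw [wedge_apply_insert hU, koszulD_apply, hcompl, Finset.sum_insert (by simp), mul_add,
      show koszulSign K v U * (koszulSign K v U * X v * c (insert v U)) =
        (koszulSign K v U * koszulSign K v U) * X v * c (insert v U) by ring,
      koszulSign_mul_self, one_mul, sub_add_cancel_left, Finset.mul_sum, ← Finset.sum_neg_distrib]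
    refine Finset.sum_congr rfl fun t ht => ?_
    rw [Finset.mem_compl, Finset.mem_insert, not_or] at ht
    obtain ⟨htv, htU⟩ := ht
    rw [Finset.insert_comm t v U, wedge_apply_insert (by simp [Ne.symm htv, hU]),
      koszulSign_insert hU, koszulSign_insert htU]
    rcases lt_or_gt_of_ne (toLex.injective.ne htv) with h | h
    · rw [if_neg h.not_gt, if_pos h]; ring
    · rw [if_neg h.not_gt, if_pos h]; ring
  · rw [wedge_apply_of_notMem hv, sub_zero, Finset.sum_eq_single v]
    · rw [wedge_apply_insert hv, show koszulSign K v T * X v * (koszulSign K v T * c T) =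
        (koszulSign K v T * koszulSign K v T) * X v * c T by ring, koszulSign_mul_self, one_mul]
    · intro t ht htv
      rw [wedge_apply_of_notMem (by simp [hv, Ne.symm htv]), mul_zero]
    · intro h; exact absurd (Finset.mem_compl.2 hv) h

/-- The Leibniz rule gives $d^2(e_v\wedge c)=e_v\wedge d^2c$, so it suffices to build up $e_T$ one
factor at a time. -/
theorem koszulD_koszulD (c : Finset (Fin n × Fin 2) → MvPolynomial (Fin n × Fin 2) K) :
    koszulD (koszulD c) = 0 := by
  have hsingle : ∀ (T : Finset (Fin n × Fin 2)) (f : MvPolynomial (Fin n × Fin 2) K),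
      koszulD (koszulD (Pi.single T f)) = 0 := by
    intro T
    induction T using Finset.induction_on with
    | empty =>
      intro f
      have : koszulD (Pi.single (∅ : Finset (Fin n × Fin 2)) f) = 0 := by
        funext U
        rw [koszulD_apply]
        refine Finset.sum_eq_zero fun v _ => ?_
        rw [Pi.single_eq_of_ne (Finset.insert_ne_empty v U), mul_zero]
      rw [this, map_zero]
    | insert v T hv ih =>
      intro f
      have : Pi.single (insert v T) f = wedge v (Pi.single T (koszulSign K v T * f)) := by
        funext U
        by_cases hU : v ∈ U
        · obtain ⟨W, hW, rfl⟩ : ∃ W, v ∉ W ∧ insert v W = U :=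
            ⟨U.erase v, Finset.notMem_erase v U, Finset.insert_erase hU⟩
          rw [wedge_apply_insert hW]
          by_cases h : W = T
          · subst h
            rw [Pi.single_eq_same, Pi.single_eq_same, ← mul_assoc, koszulSign_mul_self, one_mul]
          · have : insert v W ≠ insert v T := fun h' => h (by
              rw [← Finset.erase_insert hW, h', Finset.erase_insert hv])
            rw [Pi.single_eq_of_ne h, Pi.single_eq_of_ne this, mul_zero]
        · rw [wedge_apply_of_notMem hU, Pi.single_eq_of_ne]
          rintro rfl
          exact hU (Finset.mem_insert_self v T)
      rw [this, koszulD_wedge, map_sub, koszulD_smul, koszulD_wedge, ih, wedge_zero, sub_zero,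
        sub_self]
  rw [← Finset.univ_sum_single c, map_sum, map_sum]
  exact Finset.sum_eq_zero fun T _ => hsingle T _

/-! ### Multigraded chains -/

/-- The multidegree of `e_T`. -/
noncomputable def setDeg (T : Finset (Fin n × Fin 2)) : Fin n →₀ ℕ :=
  ∑ v ∈ T, Finsupp.single v.1 1

theorem setDeg_insert {v : Fin n × Fin 2} {T : Finset (Fin n × Fin 2)} (h : v ∉ T) :
    setDeg (insert v T) = Finsupp.single v.1 1 + setDeg T := by
  rw [setDeg, Finset.sum_insert h, setDeg]

/-- The elements of `I` whose monomials have total degree `s` and multidegree `a - b`. -/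
noncomputable def cell (I : Ideal (MvPolynomial (Fin n × Fin 2) K)) (s : ℕ) (a b : Fin n →₀ ℕ) :
    Submodule K (MvPolynomial (Fin n × Fin 2) K) where
  carrier := {f | f ∈ I ∧ ∀ d ∈ f.support, Finsupp.weight mdeg d + b = a ∧ d.degree = s}
  zero_mem' := ⟨I.zero_mem, by simp⟩
  add_mem' := by
    classical
    rintro f g ⟨hf, hf'⟩ ⟨hg, hg'⟩
    exact ⟨I.add_mem hf hg, fun d hd =>
      (Finset.mem_union.1 (support_add hd)).elim (hf' d) (hg' d)⟩
  smul_mem' := by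
    rintro r f ⟨hf, hf'⟩
    exact ⟨Submodule.smul_of_tower_mem I r hf, fun d hd => hf' d (support_smul hd)⟩

theorem mem_cell {I : Ideal (MvPolynomial (Fin n × Fin 2) K)} {s : ℕ} {a b : Fin n →₀ ℕ}
    {f : MvPolynomial (Fin n × Fin 2) K} : f ∈ cell I s a b ↔
      f ∈ I ∧ ∀ d ∈ f.support, Finsupp.weight mdeg d + b = a ∧ d.degree = s := Iff.rfl

theorem cell_add_right (I : Ideal (MvPolynomial (Fin n × Fin 2) K)) (s : ℕ)
    (a b e : Fin n →₀ ℕ) : cell I s (a + e) (b + e) = cell I s a b := by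
  ext f
  simp only [mem_cell, ← add_assoc, add_left_inj]

theorem X_mul_mem_cell_iff {I : Ideal (MvPolynomial (Fin n × Fin 2) K)} {s : ℕ}
    {a b : Fin n →₀ ℕ} {f : MvPolynomial (Fin n × Fin 2) K} {v : Fin n × Fin 2} :
    X v * f ∈ cell I (s + 1) a b ↔
      X v * f ∈ I ∧ f ∈ cell ⊤ s a (Finsupp.single v.1 1 + b) := by
  simp only [mem_cell, support_X_mul, Finset.mem_map, addLeftEmbedding_apply,
    forall_exists_index, and_imp, forall_apply_eq_imp_iff₂, map_add, weight_mdeg_single,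
    Finsupp.degree_single, Submodule.mem_top, true_and]
  refine and_congr_right fun _ => forall₂_congr fun d _ => ?_
  rw [add_comm 1, add_left_inj, ← add_assoc, add_comm (Finsupp.single v.1 1)]

theorem koszulSign_mul_mem_iff {N : Submodule K (MvPolynomial (Fin n × Fin 2) K)}
    {f : MvPolynomial (Fin n × Fin 2) K} (v : Fin n × Fin 2) (T : Finset (Fin n × Fin 2)) :
    koszulSign K v T * f ∈ N ↔ f ∈ N := by
  rw [koszulSign]
  rcases neg_one_pow_eq_or (MvPolynomial (Fin n × Fin 2) K)
    (T.filter fun t => toLex t < toLex v).card with h | h <;> simp [h]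

/-- The Koszul chains of multidegree `a` whose coefficients in `I` have total degree `s`. -/
noncomputable def gradedChains (I : Ideal (MvPolynomial (Fin n × Fin 2) K)) (s : ℕ)
    (a : Fin n →₀ ℕ) : Submodule K (Finset (Fin n × Fin 2) → MvPolynomial (Fin n × Fin 2) K) :=
  Submodule.pi Set.univ fun T => cell I s a (setDeg T)

theorem mem_gradedChains {I : Ideal (MvPolynomial (Fin n × Fin 2) K)} {s : ℕ} {a : Fin n →₀ ℕ}
    {c : Finset (Fin n × Fin 2) → MvPolynomial (Fin n × Fin 2) K} :
    c ∈ gradedChains I s a ↔ ∀ T, c T ∈ cell I s a (setDeg T) := by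
  simp [gradedChains, Submodule.mem_pi]

theorem cell_mono {I J : Ideal (MvPolynomial (Fin n × Fin 2) K)} (h : I ≤ J) (s : ℕ)
    (a b : Fin n →₀ ℕ) : cell I s a b ≤ cell J s a b := fun _ hf => ⟨h hf.1, hf.2⟩

theorem gradedChains_mono {I J : Ideal (MvPolynomial (Fin n × Fin 2) K)} (h : I ≤ J) (s : ℕ)
    (a : Fin n →₀ ℕ) : gradedChains I s a ≤ gradedChains J s a := fun _ hc =>
  mem_gradedChains.2 fun T => cell_mono h s a _ (mem_gradedChains.1 hc T)

theorem koszulD_mem_gradedChains {I : Ideal (MvPolynomial (Fin n × Fin 2) K)} {s : ℕ}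
    {a : Fin n →₀ ℕ} {c : Finset (Fin n × Fin 2) → MvPolynomial (Fin n × Fin 2) K}
    (hc : c ∈ gradedChains I s a) : koszulD c ∈ gradedChains I (s + 1) a := by
  rw [mem_gradedChains] at hc ⊢
  intro T
  rw [koszulD_apply]
  refine sum_mem fun v hv => ?_
  rw [mul_assoc, koszulSign_mul_mem_iff, X_mul_mem_cell_iff,
    ← setDeg_insert (Finset.mem_compl.1 hv)]
  exact ⟨Ideal.mul_mem_left _ _ (hc _).1, cell_mono le_top _ _ _ (hc _)⟩

theorem wedge_mem_gradedChains {I : Ideal (MvPolynomial (Fin n × Fin 2) K)} {s : ℕ}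
    {a : Fin n →₀ ℕ} {c : Finset (Fin n × Fin 2) → MvPolynomial (Fin n × Fin 2) K}
    (v : Fin n × Fin 2) (hc : c ∈ gradedChains I s a) :
    wedge v c ∈ gradedChains I s (a + Finsupp.single v.1 1) := by
  rw [mem_gradedChains] at hc ⊢
  intro T
  by_cases hv : v ∈ T
  · obtain ⟨U, hU, rfl⟩ : ∃ U, v ∉ U ∧ insert v U = T :=
      ⟨T.erase v, Finset.notMem_erase v T, Finset.insert_erase hv⟩
    rw [wedge_apply_insert hU, koszulSign_mul_mem_iff, setDeg_insert hU, add_comm _ (setDeg U),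
      cell_add_right]
    exact hc U
  · rw [wedge_apply_of_notMem hv]; exact zero_mem _

theorem X_smul_mem_gradedChains {I J : Ideal (MvPolynomial (Fin n × Fin 2) K)} {s : ℕ}
    {a : Fin n →₀ ℕ} {c : Finset (Fin n × Fin 2) → MvPolynomial (Fin n × Fin 2) K}
    (v : Fin n × Fin 2) (hIJ : ∀ f ∈ I, X v * f ∈ J) (hc : c ∈ gradedChains I s a) :
    (X v : MvPolynomial (Fin n × Fin 2) K) • c ∈
      gradedChains J (s + 1) (a + Finsupp.single v.1 1) := by
  rw [mem_gradedChains] at hc ⊢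
  intro T
  rw [Pi.smul_apply, smul_eq_mul, X_mul_mem_cell_iff, add_comm _ (setDeg T), cell_add_right]
  exact ⟨hIJ _ (hc T).1, cell_mono le_top _ _ _ (hc T)⟩

theorem degree_weight_mdeg (d : Fin n × Fin 2 →₀ ℕ) :
    (Finsupp.weight mdeg d).degree = d.degree := by
  rw [Finsupp.degree_eq_sum, Finsupp.degree_eq_sum, Fintype.sum_prod_type]
  exact Finset.sum_congr rfl fun i _ => by rw [weight_mdeg_apply, Fin.sum_univ_two]

/-! ### Exactness of the Koszul complex in high degrees -/

/-- The two variables of $k$ are consecutive in the lexicographic order. -/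
theorem koszulSign_one_eq_zero {k : Fin n} {T : Finset (Fin n × Fin 2)} (h : (k, 0) ∉ T) :
    koszulSign K (k, 1) T = koszulSign K (k, 0) T := by
  rw [koszulSign, koszulSign]
  congr 2
  refine Finset.filter_congr ?_
  rintro ⟨i, e⟩ ht
  rw [Prod.Lex.toLex_lt_toLex, Prod.Lex.toLex_lt_toLex]
  refine or_congr_right (and_congr_right fun hi => ?_)
  have hi : i = k := hi
  subst hi
  have he : e ≠ 0 := by rintro rfl; exact h ht
  clear hi ht
  change e < 1 ↔ e < 0
  revert he; revert e; decide

theorem setDeg_apply_eq_zero {k : Fin n} {T : Finset (Fin n × Fin 2)} (h0 : (k, 0) ∉ T)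
    (h1 : (k, 1) ∉ T) : setDeg T k = 0 := by
  rw [setDeg, Finsupp.finsetSum_apply]
  refine Finset.sum_eq_zero ?_
  rintro ⟨i, e⟩ ht
  rw [Finsupp.single_apply, if_neg]
  intro hi
  have hi : i = k := hi
  subst hi
  clear * - ht h0 h1
  revert e
  rw [Fin.forall_fin_two]
  exact ⟨fun h => absurd h h0, fun h => absurd h h1⟩

theorem exists_mem_cell_X_mul_add_X_mul {G : SimpleGraph (Fin n)} {k : Fin n} {s : ℕ}
    {a b : Fin n →₀ ℕ} (ha : a k ≠ 0) (hb : b k = 0) {f : MvPolynomial (Fin n × Fin 2) K}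
    (hf : f ∈ cell (binomialEdgeIdeal K G) (s + 1) (a + Finsupp.single k 1) b) :
    ∃ p ∈ cell (binomialEdgeIdeal K G) s a b, ∃ q ∈ cell (binomialEdgeIdeal K G) s a b,
      f = X (k, 0) * p + X (k, 1) * q := by
  by_cases hf0 : f = 0
  · exact ⟨0, zero_mem _, 0, zero_mem _, by simp [hf0]⟩
  obtain ⟨d, hd⟩ := support_nonempty.2 hf0
  obtain ⟨hw, hs⟩ := hf.2 d hd
  obtain ⟨b', hb'⟩ : ∃ b', Finsupp.weight mdeg d = b' + Finsupp.single k 1 := by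
    refine ⟨Finsupp.weight mdeg d - Finsupp.single k 1, (tsub_add_cancel_of_le ?_).symm⟩
    have := DFunLike.congr_fun hw k
    simp [hb] at this
    simp [Finsupp.single_le_iff, this]
  have hb'a : b' + b = a := by
    rw [hb', add_right_comm] at hw
    exact add_right_cancel hw
  have hhom : IsWeightedHomogeneous mdeg f (b' + Finsupp.single k 1) := fun e he => by
    rw [← hb']
    exact add_right_cancel (((hf.2 e (mem_support_iff.2 he)).1).trans hw.symm)
  have hdeg : b'.degree = s := by
    have := congrArg Finsupp.degree hb'
    rw [degree_weight_mdeg, hs, map_add, Finsupp.degree_single] at this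
    omega
  obtain ⟨p, hp, q, hq, hpw, hqw, h⟩ := exists_X_mul_add_X_mul (k := k) (b := b')
    (by rw [← hb'a, Finsupp.add_apply, hb, add_zero] at ha; exact ha) hf.1
  rw [hhom.weightedHomogeneousComponent_same] at h
  have hcell : ∀ p ∈ binomialEdgeIdeal K G, IsWeightedHomogeneous mdeg p b' →
      p ∈ cell (binomialEdgeIdeal K G) s a b := fun p hp hpw => ⟨hp, fun e he => by
    have he' := hpw (mem_support_iff.1 he)
    rw [← degree_weight_mdeg, he']
    exact ⟨hb'a, hdeg⟩⟩
  exact ⟨p, hcell p hp hpw, q, hcell q hq hqw, h⟩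

theorem exists_eq_X_mul_of_X_mul_add {σ : Type*} {x y : σ} (hxy : x ≠ y)
    {A B : MvPolynomial σ K} (h : X x * A + X y * B = 0) : ∃ p, A = X y * p ∧ B = -(X x * p) := by
  have hdvd : X y ∣ X x * A := ⟨-B, by linear_combination h⟩
  rcases X_dvd_mul_iff.1 hdvd with h' | ⟨p, rfl⟩
  · exact absurd (X_dvd_X.1 h') hxy.symm
  · refine ⟨p, rfl, ?_⟩
    refine mul_left_cancel₀ (X_ne_zero y) ?_
    linear_combination h

theorem koszulD_wedge_wedge (x y : Fin n × Fin 2)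
    (h : Finset (Fin n × Fin 2) → MvPolynomial (Fin n × Fin 2) K) :
    koszulD (wedge x (wedge y h)) = (X x : MvPolynomial (Fin n × Fin 2) K) • wedge y h -
      (X y : MvPolynomial (Fin n × Fin 2) K) • wedge x h + wedge x (wedge y (koszulD h)) := by
  rw [koszulD_wedge, koszulD_wedge, wedge_sub, wedge_smul]
  abel

/-- A cycle without components `e_T` such that `xₖ, yₖ ∉ T` is of the form `d(xₖ ∧ yₖ ∧ h)`. -/
theorem exists_koszulD_wedge_wedge_eq (k : Fin n)
    {c : Finset (Fin n × Fin 2) → MvPolynomial (Fin n × Fin 2) K} (hc : koszulD c = 0)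
    (hc0 : ∀ T, (k, 0) ∉ T → (k, 1) ∉ T → c T = 0) :
    ∃ h : Finset (Fin n × Fin 2) → MvPolynomial (Fin n × Fin 2) K,
      (∀ T, (k, 0) ∈ T ∨ (k, 1) ∈ T → h T = 0) ∧
      (∀ T, (k, 0) ∉ T → (k, 1) ∉ T →
        c (insert (k, 1) T) = koszulSign K (k, 1) T * (X (k, 0) * h T) ∧
        c (insert (k, 0) T) = koszulSign K (k, 0) T * -(X (k, 1) * h T)) ∧
      koszulD (wedge (k, 0) (wedge (k, 1) h)) = c := by
  have hne : ((k, 0) : Fin n × Fin 2) ≠ (k, 1) := by simp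
  have hex : ∀ T, ∃ p : MvPolynomial (Fin n × Fin 2) K, ((k, 0) ∈ T ∨ (k, 1) ∈ T → p = 0) ∧
      ((k, 0) ∉ T → (k, 1) ∉ T →
        c (insert (k, 1) T) = koszulSign K (k, 1) T * (X (k, 0) * p) ∧
        c (insert (k, 0) T) = koszulSign K (k, 0) T * -(X (k, 1) * p)) := by
    intro T
    by_cases hT : (k, 0) ∈ T ∨ (k, 1) ∈ T
    · exact ⟨0, fun _ => rfl, fun h0 h1 => absurd hT (by tauto)⟩
    obtain ⟨h0, h1⟩ := not_or.1 hT
    have hd := congrFun hc T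
    -- By `hc0` only the terms of $x_k$ and $y_k$ survive, so the cycle condition at $T$ is a syzygy
    -- of these two variables and yields $p$.
    rw [koszulD_apply, Finset.sum_eq_add (k, 0) (k, 1) hne ?_ (by simp [h0]) (by simp [h1])] at hd
    · rw [koszulSign_one_eq_zero h0, mul_assoc, mul_assoc, ← mul_add, Pi.zero_apply] at hd
      have hs := koszulSign_mul_self (K := K) (k, 0) T
      have hd' : X (k, 0) * c (insert (k, 0) T) + X (k, 1) * c (insert (k, 1) T) = 0 := by
        linear_combination koszulSign K (k, 0) T * hd -
          (X (k, 0) * c (insert (k, 0) T) + X (k, 1) * c (insert (k, 1) T)) * hs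
      obtain ⟨p, hp1, hp2⟩ := exists_eq_X_mul_of_X_mul_add hne hd'
      refine ⟨-(koszulSign K (k, 0) T * p), fun h => absurd h hT, fun _ _ => ⟨?_, ?_⟩⟩
      · rw [hp2, koszulSign_one_eq_zero h0]
        linear_combination (X (k, 0) * p) * hs
      · rw [hp1]
        linear_combination -(X (k, 1) * p) * hs
    · rintro v hv ⟨hv0, hv1⟩
      rw [hc0 _ (by simp [h0, Ne.symm hv0]) (by simp [h1, Ne.symm hv1]), mul_zero]
  choose h hh0 hh using hex
  refine ⟨h, hh0, hh, ?_⟩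
  rw [← sub_eq_zero, ← neg_eq_zero, neg_sub]
  -- The difference $b$ is a cycle vanishing on every set without $y_k$. The cycle condition at such
  -- a set $U$ reduces to $y_k\,b_{U\cup\{y_k\}}=0$, hence $b=0$.
  set b := c - koszulD (wedge (k, 0) (wedge (k, 1) h)) with hb
  have hdb : koszulD b = 0 := by rw [hb, map_sub, hc, koszulD_koszulD, sub_zero]
  have hbv : ∀ T, b T = c T - (X (k, 0) * wedge (k, 1) h T - X (k, 1) * wedge (k, 0) h T +
      wedge (k, 0) (wedge (k, 1) (koszulD h)) T) := fun T => by
    rw [hb, koszulD_wedge_wedge]; rfl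
  have hb0 : ∀ T, (k, 1) ∉ T → b T = 0 := by
    intro T h1
    by_cases h0 : (k, 0) ∈ T
    · obtain ⟨U, hU, rfl⟩ : ∃ U, (k, 0) ∉ U ∧ insert (k, 0) U = T :=
        ⟨T.erase (k, 0), Finset.notMem_erase _ T, Finset.insert_erase h0⟩
      have hU1 : (k, 1) ∉ U := fun h => h1 (Finset.mem_insert_of_mem h)
      rw [hbv, wedge_apply_of_notMem h1, wedge_apply_insert hU, wedge_apply_insert hU,
        wedge_apply_of_notMem hU1, (hh U hU hU1).2]
      ring
    · rw [hbv, wedge_apply_of_notMem h1, wedge_apply_of_notMem h0, wedge_apply_of_notMem h0,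
        hc0 T h0 h1]
      ring
  funext T
  by_cases h1 : (k, 1) ∈ T
  · obtain ⟨U, hU, rfl⟩ : ∃ U, (k, 1) ∉ U ∧ insert (k, 1) U = T :=
      ⟨T.erase (k, 1), Finset.notMem_erase _ T, Finset.insert_erase h1⟩
    have hd := congrFun hdb U
    rw [koszulD_apply, Finset.sum_eq_single (k, 1)] at hd
    · have hs := koszulSign_mul_self (K := K) (k, 1) U
      refine mul_left_cancel₀ (X_ne_zero (R := K) ((k, 1) : Fin n × Fin 2)) ?_
      simp only [Pi.zero_apply] at hd ⊢
      linear_combination koszulSign K (k, 1) U * hd - (X (k, 1) * b (insert (k, 1) U)) * hs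
    · intro v _ hv
      rw [hb0 _ (by simp [hU, Ne.symm hv]), mul_zero]
    · intro h; simp [hU] at h
  · exact hb0 T h1

theorem exists_apply_ge_two {a : Fin n →₀ ℕ} (h : a.support.card < a.degree) :
    ∃ k, 2 ≤ a k := by
  by_contra! hlt
  refine absurd h (not_lt.2 ?_)
  rw [Finsupp.degree_apply, Finset.card_eq_sum_ones]
  exact Finset.sum_le_sum fun k _ => Nat.le_of_lt_succ (hlt k)

theorem gradedChains_eq_zero_of_degree_lt {I : Ideal (MvPolynomial (Fin n × Fin 2) K)} {s : ℕ}
    {a : Fin n →₀ ℕ} (h : a.degree < s)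
    {c : Finset (Fin n × Fin 2) → MvPolynomial (Fin n × Fin 2) K} (hc : c ∈ gradedChains I s a) :
    c = 0 := by
  funext T
  by_contra hne
  obtain ⟨d, hd⟩ := support_nonempty.2 hne
  obtain ⟨h1, h2⟩ := (mem_gradedChains.1 hc T).2 d hd
  have := congrArg Finsupp.degree h1
  rw [map_add, degree_weight_mdeg, h2] at this
  omega

/-- Choose $k$ with $a_k\ge2$ and write $x,y$ for its variables. Modulo a boundary, the cycle is
$d(x\wedge y\wedge h)$ with $xh,yh\in J_G$. If $a_k>2$, this forces $h\in J_G$. If $a_k=2$, then $h$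
does not involve $k$ and lies in the ideal $J'$ of the completed graph, and $dh\in J_G$. The
induction, applied to both graphs in degree $a-2e_k$, gives $dh=dh_1$ over $J_G$ and $h-h_1=dh_2$
over $J'$. The inclusions $xJ',yJ'\subseteq J_G$ then allow a primitive over $J_G$. -/
theorem exists_koszulD_eq {N : ℕ} : ∀ (G : SimpleGraph (Fin n)) (s : ℕ) (a : Fin n →₀ ℕ),
    a.support.card = N → N ≤ s → ∀ c ∈ gradedChains (binomialEdgeIdeal K G) (s + 1) a,
      koszulD c = 0 → ∃ b ∈ gradedChains (binomialEdgeIdeal K G) s a, koszulD b = c := by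
  induction N using Nat.strong_induction_on with
  | _ N ih =>
  intro G s a hN hs c hc hdc
  by_cases hlt : a.support.card < a.degree
  swap
  -- Here $|a|\le|\operatorname{supp}a|\le s$, so no coefficient of degree $s+1$ fits.
  · have := gradedChains_eq_zero_of_degree_lt (by omega) hc
    exact ⟨0, zero_mem _, by rw [this, map_zero]⟩
  obtain ⟨k, hk⟩ := exists_apply_ge_two hlt
  obtain ⟨a₂, rfl⟩ : ∃ a₂, a = a₂ + Finsupp.single k 1 + Finsupp.single k 1 := by
    refine ⟨a - (Finsupp.single k 1 + Finsupp.single k 1), ?_⟩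
    rw [add_assoc, tsub_add_cancel_of_le]
    rw [← Finsupp.single_add]
    simpa [Finsupp.single_le_iff] using hk
  have hex : ∀ T, ∃ p ∈ cell (binomialEdgeIdeal K G) s (a₂ + Finsupp.single k 1) (setDeg T),
      ∃ q ∈ cell (binomialEdgeIdeal K G) s (a₂ + Finsupp.single k 1) (setDeg T),
      (k, 0) ∉ T → (k, 1) ∉ T → c T = X (k, 0) * p + X (k, 1) * q := by
    intro T
    by_cases hT : (k, 0) ∉ T ∧ (k, 1) ∉ T
    · obtain ⟨p, hp, q, hq, h⟩ := exists_mem_cell_X_mul_add_X_mul (by simp)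
        (setDeg_apply_eq_zero hT.1 hT.2) (mem_gradedChains.1 hc T)
      exact ⟨p, hp, q, hq, fun _ _ => h⟩
    · exact ⟨0, zero_mem _, 0, zero_mem _, fun h0 h1 => absurd ⟨h0, h1⟩ hT⟩
  choose f hf g hg hfg using hex
  have hf : f ∈ gradedChains _ _ _ := mem_gradedChains.2 hf
  have hg : g ∈ gradedChains _ _ _ := mem_gradedChains.2 hg
  -- Subtracting $d(x\wedge f+y\wedge g)$ cancels all coefficients at sets avoiding both variables
  -- of $k$.
  set b₁ := wedge (k, 0) f + wedge (k, 1) g with hb₁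
  have hb₁mem : b₁ ∈ gradedChains (binomialEdgeIdeal K G) s
      (a₂ + Finsupp.single k 1 + Finsupp.single k 1) :=
    add_mem (wedge_mem_gradedChains (k, 0) hf) (wedge_mem_gradedChains (k, 1) hg)
  set c' := c - koszulD b₁ with hc'
  have hc'mem : c' ∈ gradedChains (binomialEdgeIdeal K G) (s + 1)
      (a₂ + Finsupp.single k 1 + Finsupp.single k 1) :=
    sub_mem hc (koszulD_mem_gradedChains hb₁mem)
  have hdc' : koszulD c' = 0 := by rw [hc', map_sub, hdc, koszulD_koszulD, sub_zero]
  suffices ∃ b ∈ gradedChains (binomialEdgeIdeal K G) s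
      (a₂ + Finsupp.single k 1 + Finsupp.single k 1), koszulD b = c' by
    obtain ⟨b, hb, hbc⟩ := this
    exact ⟨b + b₁, add_mem hb hb₁mem, by rw [map_add, hbc, hc', sub_add_cancel]⟩
  have hc'0 : ∀ T, (k, 0) ∉ T → (k, 1) ∉ T → c' T = 0 := by
    intro T h0 h1
    rw [hc', hb₁, map_add, koszulD_wedge, koszulD_wedge]
    simp only [Pi.sub_apply, Pi.add_apply, Pi.smul_apply, smul_eq_mul,
      wedge_apply_of_notMem h0, wedge_apply_of_notMem h1, sub_zero, hfg T h0 h1, sub_self]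
  obtain ⟨h, hh0, hhc, hdh⟩ := exists_koszulD_wedge_wedge_eq k hdc' hc'0
  have hcell : ∀ T (e : Fin 2), X (k, e) * h T ∈ cell (binomialEdgeIdeal K G) (s + 1)
      (a₂ + Finsupp.single k 1 + Finsupp.single k 1) (Finsupp.single k 1 + setDeg T) := by
    intro T
    by_cases hT : (k, 0) ∈ T ∨ (k, 1) ∈ T
    · intro e; rw [hh0 T hT, mul_zero]; exact zero_mem _
    obtain ⟨h0, h1⟩ := not_or.1 hT
    obtain ⟨hc1, hc0⟩ := hhc T h0 h1
    rw [Fin.forall_fin_two]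
    constructor
    · have := mem_gradedChains.1 hc'mem (insert (k, 1) T)
      rwa [hc1, koszulSign_mul_mem_iff, setDeg_insert h1] at this
    · have := mem_gradedChains.1 hc'mem (insert (k, 0) T)
      rwa [hc0, koszulSign_mul_mem_iff, setDeg_insert h0, neg_mem_iff] at this
  have hhtop : h ∈ gradedChains ⊤ s a₂ := by
    rw [mem_gradedChains]
    intro T
    have := (X_mul_mem_cell_iff.1 (hcell T 0)).2
    rwa [add_comm _ (setDeg T), ← add_assoc, add_comm _ (setDeg T), cell_add_right,
      add_comm (setDeg T), ← add_comm (setDeg T), cell_add_right] at this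
  have hhom : ∀ T, h T ≠ 0 → ∃ b, IsWeightedHomogeneous mdeg (h T) b ∧ b k = a₂ k := by
    intro T hT
    have h0 : (k, 0) ∉ T := fun h' => hT (hh0 T (Or.inl h'))
    have h1 : (k, 1) ∉ T := fun h' => hT (hh0 T (Or.inr h'))
    obtain ⟨d, hd⟩ := support_nonempty.2 hT
    have hmem := (mem_gradedChains.1 hhtop T).2
    refine ⟨Finsupp.weight mdeg d, fun e he =>
      add_right_cancel ((hmem e (mem_support_iff.2 he)).1.trans (hmem d hd).1.symm), ?_⟩
    rw [← (hmem d hd).1, Finsupp.add_apply, setDeg_apply_eq_zero h0 h1, add_zero]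
  by_cases hak : a₂ k = 0
  swap
  · have hhJ : h ∈ gradedChains (binomialEdgeIdeal K G) s a₂ := by
      rw [mem_gradedChains]
      intro T
      refine ⟨?_, (mem_gradedChains.1 hhtop T).2⟩
      by_cases hT : h T = 0
      · rw [hT]; exact zero_mem _
      obtain ⟨b, hb, hbk⟩ := hhom T hT
      exact mem_of_X_mul_mem hb (v := (k, 0)) (hbk.trans_ne hak) (hcell T 0).1
    exact ⟨_, wedge_mem_gradedChains (k, 0) (wedge_mem_gradedChains (k, 1) hhJ), hdh⟩
  have hcard : a₂.support.card + 1 = N := by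
    rw [← hN]
    have : (a₂ + Finsupp.single k 1 + Finsupp.single k 1).support = insert k a₂.support := by
      ext i
      simp only [Finsupp.mem_support_iff, Finsupp.add_apply, Finsupp.single_apply,
        Finset.mem_insert]
      split_ifs with hi
      · subst hi; simp
      · simp [Ne.symm hi]
    rw [this, Finset.card_insert_of_notMem (by simp [hak])]
  have hhC : h ∈ gradedChains (binomialEdgeIdeal K (completeAt G k)) s a₂ := by
    rw [mem_gradedChains]
    intro T
    refine ⟨?_, (mem_gradedChains.1 hhtop T).2⟩
    by_cases hT : h T = 0
    · rw [hT]; exact zero_mem _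
    obtain ⟨b, hb, hbk⟩ := hhom T hT
    exact mem_completeAt_of_X_mul_mem hb (v := (k, 0)) (hbk.trans hak) (hcell T 0).1
  have hdhJ : koszulD h ∈ gradedChains (binomialEdgeIdeal K G) (s + 1) a₂ := by
    have htop := mem_gradedChains.1 (koszulD_mem_gradedChains hhtop)
    rw [mem_gradedChains]
    intro T
    refine ⟨?_, (htop T).2⟩
    by_cases hT : (k, 0) ∈ T ∨ (k, 1) ∈ T
    · have : koszulD h T = 0 := by
        rw [koszulD_apply]
        refine Finset.sum_eq_zero fun v _ => ?_
        rw [hh0 _ (hT.imp Finset.mem_insert_of_mem Finset.mem_insert_of_mem), mul_zero]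
      rw [this]; exact zero_mem _
    · obtain ⟨h0, h1⟩ := not_or.1 hT
      have h0' : (k, 0) ∉ insert (k, 1) T := by simp [h0]
      -- Up to sign, the coefficient of $d(x\wedge y\wedge h)$ at $T\cup\{x,y\}$ is $(dh)_T$.
      have hmem := (mem_gradedChains.1 hc'mem (insert (k, 0) (insert (k, 1) T))).1
      rw [← hdh, koszulD_wedge_wedge] at hmem
      simp only [Pi.add_apply, Pi.sub_apply, Pi.smul_apply] at hmem
      rw [wedge_apply_insert h0', wedge_apply_insert h0', wedge_apply_insert h1,
        Finset.insert_comm, wedge_apply_insert (by simp [h1]), hh0 (insert (k, 0) T) (by simp),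
        hh0 (insert (k, 1) T) (by simp)] at hmem
      simp only [mul_zero, smul_zero, sub_zero, zero_add] at hmem
      exact (koszulSign_mul_mem_iff (N := (binomialEdgeIdeal K G).restrictScalars K) _ _).1
        ((koszulSign_mul_mem_iff (N := (binomialEdgeIdeal K G).restrictScalars K) _ _).1 hmem)
  obtain ⟨h₁, hh₁, hdh₁⟩ := ih a₂.support.card (by omega) G s a₂ rfl (by omega) (koszulD h) hdhJ
    (koszulD_koszulD h)
  -- The coefficients of $h-h_1$ have degree $s$, not $s+1$. The loss is compensated by the support
  -- of $a_2$ having one vertex fewer.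
  obtain ⟨s, rfl⟩ : ∃ s', s = s' + 1 := ⟨s - 1, by omega⟩
  obtain ⟨h₂, hh₂, hdh₂⟩ := ih a₂.support.card (by omega) (completeAt G k) s a₂ rfl (by omega)
    (h - h₁) (sub_mem hhC (gradedChains_mono (binomialEdgeIdeal_le_completeAt G k) _ _ hh₁))
    (by rw [map_sub, hdh₁, sub_self])
  -- The last two terms equal $x\wedge y\wedge dh_2-d(x\wedge y\wedge h_2)$, so the differential of
  -- the whole is $d(x\wedge y\wedge(h_1+dh_2))=d(x\wedge y\wedge h)$.
  refine ⟨wedge (k, 0) (wedge (k, 1) h₁) +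
    ((X (k, 1) : MvPolynomial (Fin n × Fin 2) K) • wedge (k, 0) h₂ -
      (X (k, 0) : MvPolynomial (Fin n × Fin 2) K) • wedge (k, 1) h₂), ?_, ?_⟩
  · refine add_mem (wedge_mem_gradedChains (k, 0) (wedge_mem_gradedChains (k, 1) hh₁))
      (sub_mem ?_ ?_)
    · exact X_smul_mem_gradedChains (k, 1) (fun f hf => X_mul_mem_of_mem_completeAt hf)
        (wedge_mem_gradedChains (k, 0) hh₂)
    · exact X_smul_mem_gradedChains (k, 0) (fun f hf => X_mul_mem_of_mem_completeAt hf)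
        (wedge_mem_gradedChains (k, 1) hh₂)
  · have h1 : (X (k, 1) : MvPolynomial (Fin n × Fin 2) K) • wedge (k, 0) h₂ -
        (X (k, 0) : MvPolynomial (Fin n × Fin 2) K) • wedge (k, 1) h₂ =
        wedge (k, 0) (wedge (k, 1) (koszulD h₂)) - koszulD (wedge (k, 0) (wedge (k, 1) h₂)) := by
      rw [koszulD_wedge_wedge]; abel
    rw [map_add, h1, map_sub, koszulD_koszulD, sub_zero, ← map_add, ← wedge_add, ← wedge_add,
      hdh₂, add_sub_cancel, hdh]

/-! ### Regularity -/

open Classical in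
/-- The part of multidegree `a - b`. -/
noncomputable def shiftedComponent (K : Type u) [Field K] (a b : Fin n →₀ ℕ) :
    MvPolynomial (Fin n × Fin 2) K →ₗ[K] MvPolynomial (Fin n × Fin 2) K :=
  if b ≤ a then weightedHomogeneousComponent mdeg (a - b) else 0

theorem coeff_shiftedComponent (a b : Fin n →₀ ℕ) (f : MvPolynomial (Fin n × Fin 2) K)
    (d : Fin n × Fin 2 →₀ ℕ) [Decidable (Finsupp.weight mdeg d + b = a)] :
    coeff d (shiftedComponent K a b f) =
      if Finsupp.weight mdeg d + b = a then coeff d f else 0 := by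
  classical
  rw [shiftedComponent]
  split_ifs with h1 h2 h2
  · rw [coeff_weightedHomogeneousComponent, if_pos (by rw [← h2, add_tsub_cancel_right])]
  · rw [coeff_weightedHomogeneousComponent, if_neg]
    intro h; exact h2 (by rw [h, tsub_add_cancel_of_le h1])
  · exact absurd (h2 ▸ le_add_self) h1
  · simp

theorem shiftedComponent_X_mul (a b : Fin n →₀ ℕ) (v : Fin n × Fin 2)
    (f : MvPolynomial (Fin n × Fin 2) K) :
    shiftedComponent K a b (X v * f) =
      X v * shiftedComponent K a (Finsupp.single v.1 1 + b) f := by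
  classical
  ext d
  rw [coeff_shiftedComponent, coeff_X_mul', coeff_X_mul', coeff_shiftedComponent]
  by_cases hv : v ∈ d.support
  · have : Finsupp.weight mdeg (d - Finsupp.single v 1) + (Finsupp.single v.1 1 + b) =
        Finsupp.weight mdeg d + b := by
      rw [← add_assoc, ← weight_mdeg_single v, ← map_add, tsub_add_cancel_of_le]
      simpa [Finsupp.single_le_iff] using
        Nat.one_le_iff_ne_zero.2 (Finsupp.mem_support_iff.1 hv)
    rw [if_pos hv, if_pos hv, this]
  · rw [if_neg hv, if_neg hv, ite_self]

theorem shiftedComponent_koszulD (a : Fin n →₀ ℕ)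
    (c : Finset (Fin n × Fin 2) → MvPolynomial (Fin n × Fin 2) K) :
    koszulD (fun T => shiftedComponent K a (setDeg T) (c T)) =
      fun T => shiftedComponent K a (setDeg T) (koszulD c T) := by
  funext T
  rw [koszulD_apply, koszulD_apply, map_sum]
  refine Finset.sum_congr rfl fun v hv => ?_
  rw [mul_assoc, mul_assoc, setDeg_insert (Finset.mem_compl.1 hv), ← shiftedComponent_X_mul,
    koszulSign]
  rcases neg_one_pow_eq_or (MvPolynomial (Fin n × Fin 2) K)
    (T.filter fun t => toLex t < toLex v).card with h | h <;> simp [h]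

theorem shiftedComponent_mem {I : Ideal (MvPolynomial (Fin n × Fin 2) K)} (hI : IsMultigraded I)
    (a b : Fin n →₀ ℕ) {f : MvPolynomial (Fin n × Fin 2) K} (hf : f ∈ I) :
    shiftedComponent K a b f ∈ I := by
  rw [shiftedComponent]
  split_ifs
  · exact hI f hf _
  · exact zero_mem _

theorem degree_setDeg (T : Finset (Fin n × Fin 2)) : (setDeg T).degree = T.card := by
  rw [setDeg, map_sum, Finset.card_eq_sum_ones]
  exact Finset.sum_congr rfl fun v _ => Finsupp.degree_single _ _

theorem isHomogeneous_mul_prod_X_iff {f : MvPolynomial (Fin n × Fin 2) K}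
    {T : Finset (Fin n × Fin 2)} {j : ℕ} :
    (f * ∏ v ∈ T, X v).IsHomogeneous j ↔ ∀ d ∈ f.support, d.degree + T.card = j := by
  have hprod : ∏ v ∈ T, (X v : MvPolynomial (Fin n × Fin 2) K) =
      monomial (∑ v ∈ T, Finsupp.single v 1) 1 := by
    rw [monomial_sum_one]; rfl
  have hdeg : (∑ v ∈ T, Finsupp.single v 1 : Fin n × Fin 2 →₀ ℕ).degree = T.card := by
    rw [map_sum, Finset.card_eq_sum_ones]
    exact Finset.sum_congr rfl fun v _ => Finsupp.degree_single _ _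
  constructor
  · intro h d hd
    have := h (d := d + ∑ v ∈ T, Finsupp.single v 1) (by
      rw [hprod, coeff_mul_monomial, mul_one]; exact mem_support_iff.1 hd)
    rw [← this, ← hdeg, ← map_add, Finsupp.degree_eq_weight_one]
    rfl
  · intro h
    rw [f.as_sum, Finset.sum_mul]
    refine IsHomogeneous.sum _ _ _ fun d hd => ?_
    rw [hprod, monomial_mul]
    refine isHomogeneous_monomial _ ?_
    rw [map_add, hdeg, h d hd]

/-- The differential respects multidegrees, so the cycle splits into multigraded cycles. In each of
them the coefficients have degree $r>n\ge|\operatorname{supp}a|$, and `exists_koszulD_eq` applies.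
-/
theorem koszulCycles_le_koszulBoundaries (G : SimpleGraph (Fin n)) {i r : ℕ} (hr : n < r) :
    koszulCycles (binomialEdgeIdeal K G) i (i + r) ≤
      koszulBoundaries (binomialEdgeIdeal K G) i (i + r) := by
  classical
  obtain ⟨s, rfl⟩ : ∃ s, r = s + 1 := ⟨r - 1, by omega⟩
  rintro c ⟨hc, hdc⟩
  have hdeg : ∀ T, ∀ d ∈ (c T).support, T.card = i ∧ d.degree = s + 1 := by
    intro T d hd
    have hcard : T.card = i := by
      by_contra h
      rw [(hc T).2.1 h] at hd
      simp at hd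
    have := isHomogeneous_mul_prod_X_iff.1 (hc T).2.2 d hd
    exact ⟨hcard, by omega⟩
  -- The finitely many multidegrees occurring in $c$.
  let A : Finset (Fin n →₀ ℕ) := Finset.univ.biUnion fun T =>
    (c T).support.image fun d => Finsupp.weight mdeg d + setDeg T
  have hA : ∀ a ∈ A, a.degree = i + (s + 1) := by
    intro a ha
    simp only [A, Finset.mem_biUnion, Finset.mem_univ, true_and, Finset.mem_image] at ha
    obtain ⟨T, d, hd, rfl⟩ := ha
    rw [map_add, degree_weight_mdeg, degree_setDeg, (hdeg T d hd).1, (hdeg T d hd).2, add_comm]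
  let p : (Fin n →₀ ℕ) → Finset (Fin n × Fin 2) → MvPolynomial (Fin n × Fin 2) K :=
    fun a T => shiftedComponent K a (setDeg T) (c T)
  have hp : ∀ a, p a ∈ gradedChains (binomialEdgeIdeal K G) (s + 1) a := by
    intro a
    rw [mem_gradedChains]
    refine fun T => ⟨shiftedComponent_mem (isMultigraded_binomialEdgeIdeal G) _ _ (hc T).1,
      fun d hd => ?_⟩
    rw [mem_support_iff, coeff_shiftedComponent, Ne, ite_eq_right_iff, Classical.not_imp] at hd
    exact ⟨hd.1, (hdeg T d (mem_support_iff.2 hd.2)).2⟩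
  have hdp : ∀ a, koszulD (p a) = 0 := by
    intro a
    rw [shiftedComponent_koszulD, LinearMap.mem_ker.1 hdc]
    funext T
    simp
  have hsum : ∑ a ∈ A, p a = c := by
    funext T
    ext d
    rw [Finset.sum_apply, coeff_sum]
    simp only [p, coeff_shiftedComponent]
    rw [Finset.sum_ite_eq]
    split_ifs with h
    · rfl
    · by_contra hne
      apply h
      simp only [A, Finset.mem_biUnion, Finset.mem_univ, true_and, Finset.mem_image]
      exact ⟨T, d, mem_support_iff.2 (Ne.symm hne), rfl⟩
  have hle : ∀ a : Fin n →₀ ℕ, a.support.card ≤ s := fun a =>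
    (Finset.card_le_univ _).trans (by rw [Fintype.card_fin]; omega)
  choose b hb hdb using fun a => exists_koszulD_eq G s a rfl (hle a) (p a) (hp a) (hdp a)
  refine ⟨∑ a ∈ A, b a, sum_mem fun a ha T => ?_, by rw [map_sum, ← hsum]; simp only [hdb]⟩
  obtain ⟨hbI, hbd⟩ := mem_gradedChains.1 (hb a) T
  have hcard : ∀ d ∈ (b a T).support, d.degree = s ∧ T.card = i + 1 := by
    intro d hd
    obtain ⟨h1, h2⟩ := hbd d hd
    have := congrArg Finsupp.degree h1
    rw [map_add, degree_weight_mdeg, degree_setDeg, h2, hA a ha] at this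
    exact ⟨h2, by omega⟩
  refine ⟨hbI, fun hT => ?_, isHomogeneous_mul_prod_X_iff.2 fun d hd => ?_⟩
  · by_contra hne
    obtain ⟨d, hd⟩ := support_nonempty.2 hne
    exact hT (hcard d hd).2
  · obtain ⟨h1, h2⟩ := hcard d hd
    omega

theorem gradedBetti_binomialEdgeIdeal_eq_zero (G : SimpleGraph (Fin n)) {i r : ℕ} (hr : n < r) :
    gradedBetti (binomialEdgeIdeal K G) i (i + r) = 0 := by
  rw [gradedBetti, Submodule.submoduleOf_eq_top.2 (koszulCycles_le_koszulBoundaries G hr)]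
  exact Module.finrank_zero_of_subsingleton

theorem regularity_binomialEdgeIdeal_le (G : SimpleGraph (Fin n)) :
    regularity (binomialEdgeIdeal K G) ≤ (n : WithBot ℕ∞) := by
  refine iSup_le fun i => iSup_le fun r => iSup_le fun h => ?_
  have : r ≤ n := by
    by_contra hlt
    exact h (gradedBetti_binomialEdgeIdeal_eq_zero G (not_le.1 hlt))
  exact_mod_cast this

end BinomialEdge

theorem theorem2p1 (K : Type u) [Field K] (n : ℕ) (G : SimpleGraph (Fin n)) :
    (Infinite K →
      ∀ m : MonomialOrder.{0, w} (Fin n × Fin 2),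
        (∀ i : Fin n,
          m.toSyn (Finsupp.single (i, 1) 1) < m.toSyn (Finsupp.single (i, 0) 1)) →
        BinomialEdge.IsMultigradedGin m (BinomialEdge.binomialEdgeIdeal K G)
          (BinomialEdge.pathIdeal K G)) ∧
    BinomialEdge.IsCartwrightSturmfels (BinomialEdge.binomialEdgeIdeal K G) ∧
    (∀ (m : MonomialOrder.{0, w} (Fin n × Fin 2)) (g : Fin n → GL (Fin 2) K),
      (BinomialEdge.initialIdeal m
        ((BinomialEdge.binomialEdgeIdeal K G).map (BinomialEdge.coordChange g))).IsRadical) ∧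
    BinomialEdge.regularity (BinomialEdge.binomialEdgeIdeal K G) ≤ (n : WithBot ℕ∞) := by
  refine ⟨fun _ m hm => BinomialEdge.isMultigradedGin_pathIdeal hm G,
    BinomialEdge.isCartwrightSturmfels_binomialEdgeIdeal G,
    fun m g => BinomialEdge.isRadical_initialIdeal m G g,
    BinomialEdge.regularity_binomialEdgeIdeal_le G⟩
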